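/- Let $m\ge 0$ be an integer, let $S^m\subset\mathbb{R}^{m+1}$ be the unit sphere, let $\mathbb{Z}_2$ act on $S^m\times S^m$ by exchanging the two factors, let $S^m\times S^m/\mathbb{Z}_2$ be the quotient space, and let $\Delta\subset S^m\times S^m/\mathbb{Z}_2$ be the image of the diagonal $\{(x,x):x\in S^m\}$. Then the relative singular homology with coefficients in $\mathbb{Z}_2$ is $$ H_q(S^m\times S^m/\mathbb{Z}_2,\Delta;\mathbb{Z}_2)\cong \begin{cases}\mathbb{Z}_2 & \text{if } m\le q\le 2m,\\ 0 & \text{otherwise.}\end{cases} $$ In particular $$ \sum_{q\ge 0}\dim_{\mathbb{Z}_2} H_q(S^m\times S^m/\mathbb{Z}_2,\Delta;\mathbb{Z}_2)=m+1 . $$ -/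

import Mathlib

open CategoryTheory Limits AlgebraicTopology

noncomputable section

/-- The relative singular chain complex `C_*(X, A; R) = C_*(X; R) / C_*(A; R)` of a topological
pair `(X, A)`: the cokernel of the map of singular chain complexes induced by `A → X`. -/
def relativeSingularChainComplex (R : Type) [CommRing R] (P : TopPair.{0}) :
    ChainComplex (ModuleCat.{0} R) ℕ :=
  cokernel (((singularChainComplexFunctor (ModuleCat.{0} R)).obj (ModuleCat.of R R)).map P.map)

/-- The relative singular homology `H_q(X, A; R)` of a topological pair `(X, A)`. -/
def relativeSingularHomology (R : Type) [CommRing R] (P : TopPair.{0}) (q : ℕ) :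
    ModuleCat.{0} R :=
  (relativeSingularChainComplex R P).homology q

/-- The pair `(X × X / ℤ₂, Δ)`, where `ℤ₂` acts by exchanging the two factors and `Δ` is the image
of the diagonal. Here `Sym2 X` is the quotient of `X × X` by the relation generated by
`(x, y) ∼ (y, x)`, with the quotient topology, and `Δ` has the subspace topology. -/
def symmetricSquarePair (X : Type) [TopologicalSpace X] : TopPair.{0} :=
  TopPair.ofSubset (X := TopCat.of (Sym2 X)) (Sym2.diagSet : Set (Sym2 X))

/-- The standard unit sphere `S^m` in `ℝ^(m+1)`. -/
abbrev unitSphere (m : ℕ) : Type :=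
  Metric.sphere (0 : EuclideanSpace ℝ (Fin (m + 1))) 1

end

/-!
Write `X` for the symmetric square `Sym2 (unitSphere m)` and `Δ` for the diagonal.

Moving both points of a pair to their midpoint on the sphere deforms the set of pairs which are
not antipodal onto `Δ` (`SphereSquare.acyclic_antipodal_compl_diagSet`). Hence the homology of
`(X, Δ)` is that of `(X, X ∖ P)`, where `P` is the set of unordered antipodal pairs, a real
projective space of dimension `m`. Outside `Δ` the space `X` is a manifold of dimension `2 * m`,
and a neighbourhood of `P` is a bundle of rank `m` over `P`, so the answer is the homology of a
Thom space over `P`. It is computed directly from the filtration of `P` by the projective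
subspaces `antipodal m k` of dimension `k - 1`.

The set `antipodal m (k + 1)` without `antipodal m k` is a cell, contained in the domain
`separated k` of a chart of `X ∖ Δ`: a pair of points whose `k`-th coordinates differ is described
by the direction of its difference and by its sum, which is orthogonal to the difference
(`SphereSquare.chart`). In the chart the cell is a coordinate subspace, so by excision the
homology of `(X ∖ antipodal m k, X ∖ antipodal m (k + 1))` is the local homology of a Euclidean
space along a coordinate subspace of codimension `2 * m - k`. It is one-dimensional, in that
degree (`SingChain.oneDim_and_acyclic_coordSubspace`).

The long exact sequences of the filtration have vanishing connecting homomorphisms modulo 2. A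
generator is a disc transverse to `antipodal m (k + 1)`, and its boundary sphere meets
`antipodal m (k + 2)` once on each of the two sides of `antipodal m (k + 1)`. In terms of chains, the
boundary is a sum `α + β` of chains on the two sides, which are exchanged by a reflection. As the
groups in question are one-dimensional over the field with two elements, the reflection acts
trivially on them, and `α` and `β` cancel (`SingChain.bdry_mem_relBoundaries_of_involution`). So
each `k = 0, …, m` contributes one class, in degree `2 * m - k`
(`SingChain.oneDim_and_acyclic_of_filtration`).

All of this takes place in the complex `SingChain` of singular chains modulo 2, with relative
cycles and relative boundaries as submodules of the chains of `X`. Barycentric subdivision gives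
the small simplices theorem (`SingChain.exists_add_bdry_mem_sup`), from which excision and the
Mayer–Vietoris isomorphism follow. A comparison with the singular chain complex of Mathlib
(`SingChain.sameClasses_relativeSingularChainComplex`) carries the result over.
-/

/-! ### Chains of tuples modulo 2 -/

/-- Mod 2 chains on the `n`-tuples of elements of `E`. The index counts vertices, so a tuple of
length `n` stands for an affine simplex of dimension `n - 1`, and the empty tuple makes the complex
augmented. -/
abbrev TupleChain (E : Type*) (n : ℕ) : Type _ := (Fin n → E) →₀ ZMod 2

namespace TupleChain

variable {E F : Type*}

/-- The boundary: the sum of all faces. No signs are needed modulo 2. -/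
noncomputable def bdry (n : ℕ) : TupleChain E (n + 1) →ₗ[ZMod 2] TupleChain E n :=
  Finsupp.linearCombination (ZMod 2) fun v => ∑ i, Finsupp.single (v ∘ Fin.succAbove i) 1

/-- The cone with apex `b`. -/
noncomputable def cone (b : E) (n : ℕ) : TupleChain E n →ₗ[ZMod 2] TupleChain E (n + 1) :=
  Finsupp.lmapDomain _ _ fun v => (Fin.cons b v : Fin (n + 1) → E)

/-- The map induced by a map of vertices. -/
noncomputable def map (f : E → F) (n : ℕ) : TupleChain E n →ₗ[ZMod 2] TupleChain F n :=
  Finsupp.lmapDomain _ _ fun v => f ∘ v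

@[simp] lemma bdry_single (n : ℕ) (v : Fin (n + 1) → E) :
    bdry n (Finsupp.single v 1) = ∑ i, Finsupp.single (v ∘ Fin.succAbove i) 1 := by
  simp [bdry]

@[simp] lemma cone_single (b : E) (n : ℕ) (v : Fin n → E) (a : ZMod 2) :
    cone b n (Finsupp.single v a) = Finsupp.single (Fin.cons b v : Fin (n + 1) → E) a := by
  simp [cone]

@[simp] lemma map_single (f : E → F) (n : ℕ) (v : Fin n → E) (a : ZMod 2) :
    map f n (Finsupp.single v a) = Finsupp.single (f ∘ v) a := by
  simp [map]

lemma ext_single {M : Type*} [AddCommMonoid M] [Module (ZMod 2) M] {n : ℕ}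
    {f g : TupleChain E n →ₗ[ZMod 2] M}
    (h : ∀ v, f (Finsupp.single v 1) = g (Finsupp.single v 1)) (c : TupleChain E n) :
    f c = g c := by
  have : f = g := Finsupp.lhom_ext' fun v => LinearMap.ext_ring (h v)
  rw [this]

lemma bdry_map (f : E → F) (n : ℕ) (c : TupleChain E (n + 1)) :
    bdry n (map f (n + 1) c) = map f n (bdry n c) := by
  refine ext_single (f := bdry n ∘ₗ map f (n + 1)) (g := map f n ∘ₗ bdry n) (fun v => ?_) c
  simp [Function.comp_assoc]

lemma map_cone (f : E → F) (b : E) (n : ℕ) (c : TupleChain E n) :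
    map f (n + 1) (cone b n c) = cone (f b) n (map f n c) := by
  refine ext_single (f := map f (n + 1) ∘ₗ cone b n) (g := cone (f b) n ∘ₗ map f n) (fun v => ?_) c
  simp only [LinearMap.comp_apply, cone_single, map_single]
  congr 1
  exact Fin.comp_cons f b v

lemma bdry_cone_zero (b : E) (c : TupleChain E 0) : bdry 0 (cone b 0 c) = c := by
  refine ext_single (f := bdry 0 ∘ₗ cone b 0) (g := LinearMap.id) (fun v => ?_) c
  simp only [LinearMap.comp_apply, cone_single, bdry_single, LinearMap.id_apply]
  rw [Fin.sum_univ_one]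
  congr 1

lemma bdry_cone (b : E) (n : ℕ) (c : TupleChain E (n + 1)) :
    bdry (n + 1) (cone b (n + 1) c) = c + cone b n (bdry n c) := by
  refine ext_single (f := bdry (n + 1) ∘ₗ cone b (n + 1))
    (g := LinearMap.id + cone b n ∘ₗ bdry n) (fun v => ?_) c
  simp only [LinearMap.comp_apply, cone_single, bdry_single, LinearMap.add_apply,
    LinearMap.id_apply, map_sum]
  rw [Fin.sum_univ_succ]
  congr 1
  refine Finset.sum_congr rfl fun i _ => ?_
  congr 1
  funext j
  refine Fin.cases ?_ (fun j => ?_) j <;> simp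

lemma bdry_bdry (n : ℕ) (c : TupleChain E (n + 2)) : bdry n (bdry (n + 1) c) = 0 := by
  induction n with
  | zero =>
    refine ext_single (f := bdry 0 ∘ₗ bdry 1) (g := 0) (fun v => ?_) c
    rw [LinearMap.comp_apply, ← Fin.cons_self_tail v, ← cone_single, bdry_cone, map_add,
      bdry_cone_zero]
    simp [ZModModule.add_self]
  | succ n ih =>
    refine ext_single (f := bdry (n + 1) ∘ₗ bdry (n + 2)) (g := 0) (fun v => ?_) c
    rw [LinearMap.comp_apply, ← Fin.cons_self_tail v, ← cone_single, bdry_cone, map_add,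
      bdry_cone, ih]
    simp [ZModModule.add_self]

/-- Barycentric subdivision with respect to a choice `β` of a "barycenter" of every nonempty tuple:
the cone from the barycenter over the subdivided boundary. -/
noncomputable def subdiv (β : (n : ℕ) → (Fin (n + 1) → E) → E) :
    (n : ℕ) → TupleChain E n →ₗ[ZMod 2] TupleChain E n
  | 0 => LinearMap.id
  | n + 1 => Finsupp.linearCombination (ZMod 2) fun v =>
      cone (β n v) n (subdiv β n (bdry n (Finsupp.single v 1)))

lemma subdiv_single (β : (n : ℕ) → (Fin (n + 1) → E) → E) (n : ℕ) (v : Fin (n + 1) → E) :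
    subdiv β (n + 1) (Finsupp.single v 1) =
      cone (β n v) n (subdiv β n (bdry n (Finsupp.single v 1))) := by
  simp only [subdiv, Finsupp.linearCombination_single, one_smul]

lemma bdry_subdiv (β : (n : ℕ) → (Fin (n + 1) → E) → E) (n : ℕ) (c : TupleChain E (n + 1)) :
    bdry n (subdiv β (n + 1) c) = subdiv β n (bdry n c) := by
  induction n with
  | zero =>
    refine ext_single (f := bdry 0 ∘ₗ subdiv β 1) (g := subdiv β 0 ∘ₗ bdry 0) (fun v => ?_) c
    rw [LinearMap.comp_apply, LinearMap.comp_apply, subdiv_single, bdry_cone_zero]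
  | succ n ih =>
    refine ext_single (f := bdry (n + 1) ∘ₗ subdiv β (n + 2))
      (g := subdiv β (n + 1) ∘ₗ bdry (n + 1)) (fun v => ?_) c
    rw [LinearMap.comp_apply, LinearMap.comp_apply, subdiv_single, bdry_cone, ih, bdry_bdry]
    simp

lemma map_subdiv {β : (n : ℕ) → (Fin (n + 1) → E) → E} {β' : (n : ℕ) → (Fin (n + 1) → F) → F}
    {f : E → F} (hf : ∀ n v, f (β n v) = β' n (f ∘ v)) (n : ℕ) (c : TupleChain E n) :
    map f n (subdiv β n c) = subdiv β' n (map f n c) := by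
  induction n with
  | zero => rfl
  | succ n ih =>
    refine ext_single (f := map f (n + 1) ∘ₗ subdiv β (n + 1))
      (g := subdiv β' (n + 1) ∘ₗ map f (n + 1)) (fun v => ?_) c
    rw [LinearMap.comp_apply, LinearMap.comp_apply, subdiv_single, map_cone, ih, ← bdry_map,
      map_single, subdiv_single, hf]

/-- The cone construction of a chain homotopy between two families of maps `f` and `g`: a tuple `v`
goes to the cone, with apex `β v`, over `f v + g v` and the homotopy applied to the boundary. -/
noncomputable def homotopy (β : (n : ℕ) → (Fin (n + 1) → E) → F)
    (f g : (n : ℕ) → TupleChain E n →ₗ[ZMod 2] TupleChain F n) :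
    (n : ℕ) → TupleChain E n →ₗ[ZMod 2] TupleChain F (n + 1)
  | 0 => 0
  | n + 1 => Finsupp.linearCombination (ZMod 2) fun v =>
      cone (β n v) (n + 1) (f (n + 1) (Finsupp.single v 1) + g (n + 1) (Finsupp.single v 1) +
        homotopy β f g n (bdry n (Finsupp.single v 1)))

section homotopy

variable {β : (n : ℕ) → (Fin (n + 1) → E) → F}
  {f g : (n : ℕ) → TupleChain E n →ₗ[ZMod 2] TupleChain F n}

lemma homotopy_single (n : ℕ) (v : Fin (n + 1) → E) :
    homotopy β f g (n + 1) (Finsupp.single v 1) =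
      cone (β n v) (n + 1) (f (n + 1) (Finsupp.single v 1) + g (n + 1) (Finsupp.single v 1) +
        homotopy β f g n (bdry n (Finsupp.single v 1))) := by
  simp only [homotopy, Finsupp.linearCombination_single, one_smul]

lemma bdry_homotopy (hf : ∀ n c, bdry n (f (n + 1) c) = f n (bdry n c))
    (hg : ∀ n c, bdry n (g (n + 1) c) = g n (bdry n c)) (h₀ : f 0 = g 0)
    (n : ℕ) (c : TupleChain E (n + 1)) :
    bdry (n + 1) (homotopy β f g (n + 1) c) =
      f (n + 1) c + g (n + 1) c + homotopy β f g n (bdry n c) := by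
  induction n with
  | zero =>
    refine ext_single (f := bdry 1 ∘ₗ homotopy β f g 1)
      (g := f 1 + g 1 + homotopy β f g 0 ∘ₗ bdry 0) (fun v => ?_) c
    rw [LinearMap.comp_apply, homotopy_single, bdry_cone]
    simp only [map_add, hf, hg, h₀, ZModModule.add_self]
    simp [homotopy]
  | succ n ih =>
    refine ext_single (f := bdry (n + 2) ∘ₗ homotopy β f g (n + 2))
      (g := f (n + 2) + g (n + 2) + homotopy β f g (n + 1) ∘ₗ bdry (n + 1)) (fun v => ?_) c
    rw [LinearMap.comp_apply, homotopy_single, bdry_cone]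
    rw [map_add (bdry (n + 1)), map_add (bdry (n + 1)), ih, bdry_bdry, hf, hg, map_zero, add_zero,
      ZModModule.add_self, map_zero, add_zero]
    rfl

lemma map_homotopy {E' F' : Type*} {β' : (n : ℕ) → (Fin (n + 1) → E') → F'}
    {f' g' : (n : ℕ) → TupleChain E' n →ₗ[ZMod 2] TupleChain F' n} {φ : E → E'} {ψ : F → F'}
    (hβ : ∀ n v, ψ (β n v) = β' n (φ ∘ v)) (hf : ∀ n c, map ψ n (f n c) = f' n (map φ n c))
    (hg : ∀ n c, map ψ n (g n c) = g' n (map φ n c)) (n : ℕ) (c : TupleChain E n) :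
    map ψ (n + 1) (homotopy β f g n c) = homotopy β' f' g' n (map φ n c) := by
  induction n with
  | zero => simp [homotopy]
  | succ n ih =>
    refine ext_single (f := map ψ (n + 2) ∘ₗ homotopy β f g (n + 1))
      (g := homotopy β' f' g' (n + 1) ∘ₗ map φ (n + 1)) (fun v => ?_) c
    rw [LinearMap.comp_apply, LinearMap.comp_apply, homotopy_single, map_cone,
      map_add (map ψ _), map_add (map ψ _), ih, hf, hg, ← bdry_map, map_single, homotopy_single, hβ]

end homotopy

end TupleChain

/-! ### Singular chains modulo 2 -/

/-- Mod 2 singular chains. The index counts vertices: `SingChain X (q + 1)` is the module of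
singular `q`-chains, and `SingChain X 0` is spanned by the empty simplex, which makes the complex
augmented. The augmentation cancels in relative homology. -/
abbrev SingChain (X : Type*) [TopologicalSpace X] (n : ℕ) : Type _ :=
  C(stdSimplex ℝ (Fin n), X) →₀ ZMod 2

namespace SingChain

variable {X Y Z : Type*} [TopologicalSpace X] [TopologicalSpace Y] [TopologicalSpace Z]

/-- The inclusion of the `i`-th face of the standard simplex. -/
noncomputable def face {n : ℕ} (i : Fin (n + 1)) :
    C(stdSimplex ℝ (Fin n), stdSimplex ℝ (Fin (n + 1))) :=
  ⟨stdSimplex.map i.succAbove, stdSimplex.continuous_map _⟩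

/-- The boundary: the sum of all faces. -/
noncomputable def bdry (n : ℕ) : SingChain X (n + 1) →ₗ[ZMod 2] SingChain X n :=
  Finsupp.linearCombination (ZMod 2) fun σ => ∑ i, Finsupp.single (σ.comp (face i)) 1

/-- The map of chains induced by a continuous map. -/
noncomputable def map (f : C(X, Y)) (n : ℕ) : SingChain X n →ₗ[ZMod 2] SingChain Y n :=
  Finsupp.lmapDomain _ _ fun σ => f.comp σ

/-- The chains whose simplices lie in `A`. -/
noncomputable def within (A : Set X) (n : ℕ) : Submodule (ZMod 2) (SingChain X n) :=
  Finsupp.supported (ZMod 2) (ZMod 2) {σ | Set.range σ ⊆ A}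

@[simp] lemma bdry_single (n : ℕ) (σ : C(stdSimplex ℝ (Fin (n + 1)), X)) :
    bdry n (Finsupp.single σ 1) = ∑ i, Finsupp.single (σ.comp (face i)) 1 := by
  simp [bdry]

@[simp] lemma map_single (f : C(X, Y)) (n : ℕ) (σ : C(stdSimplex ℝ (Fin n), X)) (a : ZMod 2) :
    map f n (Finsupp.single σ a) = Finsupp.single (f.comp σ) a := by
  simp [map]

lemma ext_single {M : Type*} [AddCommMonoid M] [Module (ZMod 2) M] {n : ℕ}
    {f g : SingChain X n →ₗ[ZMod 2] M}
    (h : ∀ σ, f (Finsupp.single σ 1) = g (Finsupp.single σ 1)) (c : SingChain X n) :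
    f c = g c := by
  have : f = g := Finsupp.lhom_ext' fun v => LinearMap.ext_ring (h v)
  rw [this]

lemma map_map (g : C(Y, Z)) (f : C(X, Y)) (n : ℕ) (c : SingChain X n) :
    map g n (map f n c) = map (g.comp f) n c :=
  ext_single (f := map g n ∘ₗ map f n) (g := map (g.comp f) n)
    (fun v => by simp [ContinuousMap.comp_assoc]) c

@[simp] lemma map_id (n : ℕ) (c : SingChain X n) : map (ContinuousMap.id X) n c = c :=
  ext_single (f := map (ContinuousMap.id X) n) (g := LinearMap.id) (fun v => by simp) c

lemma bdry_map (f : C(X, Y)) (n : ℕ) (c : SingChain X (n + 1)) :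
    bdry n (map f (n + 1) c) = map f n (bdry n c) :=
  ext_single (f := bdry n ∘ₗ map f (n + 1)) (g := map f n ∘ₗ bdry n)
    (fun v => by simp [ContinuousMap.comp_assoc]) c

lemma single_mem_within {A : Set X} {n : ℕ} {σ : C(stdSimplex ℝ (Fin n), X)}
    (h : Set.range σ ⊆ A) (a : ZMod 2) : Finsupp.single σ a ∈ within A n :=
  Finsupp.single_mem_supported _ _ h

/-- A linear map carries `within A n` into `p` as soon as it does so on simplices in `A`. -/
lemma map_within_le {M : Type*} [AddCommMonoid M] [Module (ZMod 2) M] {A : Set X} {n : ℕ}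
    {f : SingChain X n →ₗ[ZMod 2] M} {p : Submodule (ZMod 2) M}
    (h : ∀ σ : C(stdSimplex ℝ (Fin n), X), Set.range σ ⊆ A → f (Finsupp.single σ 1) ∈ p)
    {c : SingChain X n} (hc : c ∈ within A n) : f c ∈ p := by
  have : within A n ≤ p.comap f := by
    rw [within, Finsupp.supported_eq_span_single, Submodule.span_le]
    rintro _ ⟨σ, hσ, rfl⟩
    exact h σ hσ
  exact this hc

lemma within_mono {A B : Set X} (h : A ⊆ B) (n : ℕ) : within A n ≤ within B n :=
  Finsupp.supported_mono fun _ hσ => hσ.trans h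

lemma within_inter (A B : Set X) (n : ℕ) : within (A ∩ B) n = within A n ⊓ within B n := by
  rw [within, within, within, ← Finsupp.supported_inter]
  congr 1
  ext σ
  simp [Set.subset_inter_iff]

@[simp] lemma mem_within_univ (n : ℕ) (c : SingChain X n) : c ∈ within (Set.univ : Set X) n := by
  simp [within]

/-- The empty simplex lies in every subset. -/
lemma mem_within_zero (A : Set X) (c : SingChain X 0) : c ∈ within A 0 := by
  have : IsEmpty (stdSimplex ℝ (Fin 0)) := by
    rw [stdSimplex_of_isEmpty_index]; infer_instance
  simp [within, Set.range_eq_empty]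

/-- No nonempty simplex lies in the empty set. -/
lemma eq_zero_of_mem_within_empty {n : ℕ} {c : SingChain X (n + 1)} (hc : c ∈ within ∅ (n + 1)) :
    c = 0 := by
  simpa [within, Set.range_eq_empty_iff] using hc

lemma bdry_mem {A : Set X} {n : ℕ} {c : SingChain X (n + 1)} (hc : c ∈ within A (n + 1)) :
    bdry n c ∈ within A n := by
  refine map_within_le (fun σ hσ => ?_) hc
  rw [bdry_single]
  refine Submodule.sum_mem _ fun i _ => single_mem_within ?_ _
  exact (Set.range_comp_subset_range (face i) σ).trans hσ

lemma map_mem {A : Set X} {B : Set Y} {f : C(X, Y)} (h : Set.MapsTo f A B) {n : ℕ}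
    {c : SingChain X n} (hc : c ∈ within A n) : map f n c ∈ within B n := by
  refine map_within_le (fun σ hσ => ?_) hc
  rw [map_single]
  refine single_mem_within ?_ _
  rintro _ ⟨t, rfl⟩
  exact h (hσ ⟨t, rfl⟩)

lemma map_mem_range (f : C(X, Y)) {n : ℕ} (c : SingChain X n) :
    map f n c ∈ within (Set.range f) n :=
  map_mem (A := Set.univ) (fun x _ => Set.mem_range_self x) (mem_within_univ n c)

/-- A chain in the image of `A` under an embedding lifts to a chain in `A`. -/
lemma exists_map_eq {f : C(X, Y)} (hf : Topology.IsEmbedding f) {A : Set X} {n : ℕ}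
    {c : SingChain Y n} (hc : c ∈ within (f '' A) n) : ∃ c' ∈ within A n, map f n c' = c := by
  have : c ∈ (within A n).map (map f n) := by
    refine map_within_le (f := LinearMap.id) (fun σ hσ => ?_) hc
    have h1 : ∀ t, ∃ x, x ∈ A ∧ f x = σ t := fun t => hσ ⟨t, rfl⟩
    choose g hgA hg using h1
    have hgc : Continuous g := by
      rw [hf.continuous_iff]
      convert σ.continuous using 1
      funext t
      exact hg t
    refine ⟨Finsupp.single ⟨g, hgc⟩ 1, single_mem_within ?_ _, ?_⟩
    · rintro _ ⟨t, rfl⟩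
      exact hgA t
    · rw [map_single]
      congr 1
      ext t
      exact hg t
  exact this

lemma map_injective {f : C(X, Y)} (hf : Function.Injective f) (n : ℕ) :
    Function.Injective (map f n) :=
  Finsupp.mapDomain_injective fun σ τ h => by
    ext t
    exact hf (DFunLike.congr_fun h t)

end SingChain

/-! ### Affine simplices in convex sets -/

section Affine

variable {E F : Type*} [AddCommGroup E] [Module ℝ E] [TopologicalSpace E] [ContinuousAdd E]
  [ContinuousSMul ℝ E] [AddCommGroup F] [Module ℝ F] [TopologicalSpace F] [ContinuousAdd F]
  [ContinuousSMul ℝ F] {s : Set E} {s' : Set F}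

/-- The affine singular simplex with vertices `v` in a convex set. -/
noncomputable def affineSimplex (hs : Convex ℝ s) {n : ℕ} (v : Fin n → s) :
    C(stdSimplex ℝ (Fin n), s) where
  toFun t := ⟨∑ i, t i • (v i : E),
    hs.sum_mem (fun i _ => t.2.1 i) t.2.2 (fun i _ => (v i).2)⟩
  continuous_toFun := by
    refine Continuous.subtype_mk (continuous_finsetSum _ fun i _ => ?_) _
    exact ((continuous_apply i).comp continuous_subtype_val).smul continuous_const

lemma coe_affineSimplex (hs : Convex ℝ s) {n : ℕ} (v : Fin n → s) (t : stdSimplex ℝ (Fin n)) :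
    (affineSimplex hs v t : E) = ∑ i, t i • (v i : E) := rfl

/-- The barycenter of a nonempty tuple of points of a convex set. -/
noncomputable def tupleBarycenter (hs : Convex ℝ s) (n : ℕ) (v : Fin (n + 1) → s) : s :=
  affineSimplex hs v stdSimplex.barycenter

/-- A map of convex sets which commutes with convex combinations. -/
def IsConvexMap (hs : Convex ℝ s) (hs' : Convex ℝ s') (f : s → s') : Prop :=
  ∀ (n : ℕ) (v : Fin n → s) (t : stdSimplex ℝ (Fin n)),
    f (affineSimplex hs v t) = affineSimplex hs' (f ∘ v) t

/-- The singular chain of affine simplices given by a chain of tuples. -/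
noncomputable def realize (hs : Convex ℝ s) (n : ℕ) :
    TupleChain s n →ₗ[ZMod 2] SingChain s n :=
  Finsupp.lmapDomain _ _ (affineSimplex hs)

@[simp] lemma realize_single (hs : Convex ℝ s) (n : ℕ) (v : Fin n → s) (a : ZMod 2) :
    realize hs n (Finsupp.single v a) = Finsupp.single (affineSimplex hs v) a := by
  simp [realize]

lemma affineSimplex_comp_face (hs : Convex ℝ s) {n : ℕ} (v : Fin (n + 1) → s) (i : Fin (n + 1)) :
    (affineSimplex hs v).comp (SingChain.face i) = affineSimplex hs (v ∘ i.succAbove) := by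
  ext t
  rw [ContinuousMap.comp_apply, coe_affineSimplex, coe_affineSimplex, Fin.sum_univ_succAbove _ i]
  have h0 : (SingChain.face i t) i = 0 := by
    change (stdSimplex.map i.succAbove t) i = 0
    rw [stdSimplex.map_coe, FunOnFinite.linearMap_apply_apply]
    refine Finset.sum_eq_zero fun j hj => ?_
    simp only [Finset.mem_filter] at hj
    exact absurd hj.2 (Fin.succAbove_ne i j)
  have h1 : ∀ j, (SingChain.face i t) (i.succAbove j) = t j := by
    intro j
    change (stdSimplex.map i.succAbove t) (i.succAbove j) = t j
    rw [stdSimplex.map_coe, FunOnFinite.linearMap_apply_apply]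
    refine (Finset.sum_eq_single j (fun b hb hbj => ?_) (fun h => ?_))
    · simp only [Finset.mem_filter] at hb
      exact absurd (Fin.succAbove_right_injective hb.2) hbj
    · simp at h
  simp [h0, h1]

lemma bdry_realize (hs : Convex ℝ s) (n : ℕ) (c : TupleChain s (n + 1)) :
    SingChain.bdry n (realize hs (n + 1) c) = realize hs n (TupleChain.bdry n c) :=
  TupleChain.ext_single (f := SingChain.bdry n ∘ₗ realize hs (n + 1))
    (g := realize hs n ∘ₗ TupleChain.bdry n) (fun v => by simp [affineSimplex_comp_face]) c

lemma map_realize (hs : Convex ℝ s) (hs' : Convex ℝ s') {f : C(s, s')}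
    (hf : IsConvexMap hs hs' f) (n : ℕ) (c : TupleChain s n) :
    SingChain.map f n (realize hs n c) = realize hs' n (TupleChain.map f n c) := by
  refine TupleChain.ext_single (f := SingChain.map f n ∘ₗ realize hs n)
    (g := realize hs' n ∘ₗ TupleChain.map f n) (fun v => ?_) c
  simp only [LinearMap.comp_apply, realize_single, SingChain.map_single, TupleChain.map_single]
  congr 1
  ext t : 1
  exact hf n v t

lemma IsConvexMap.map_tupleBarycenter {hs : Convex ℝ s} {hs' : Convex ℝ s'} {f : s → s'}
    (hf : IsConvexMap hs hs' f) (n : ℕ) (v : Fin (n + 1) → s) :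
    f (tupleBarycenter hs n v) = tupleBarycenter hs' n (f ∘ v) := hf _ _ _

lemma affineSimplex_stdSimplex_apply {k n : ℕ} (w : Fin k → stdSimplex ℝ (Fin n))
    (t : stdSimplex ℝ (Fin k)) (i : Fin n) :
    affineSimplex (convex_stdSimplex ℝ (Fin n)) w t i = ∑ j, t j * w j i := by
  refine (congrFun (coe_affineSimplex _ w t) i).trans ?_
  rw [Finset.sum_apply]
  rfl

lemma isConvexMap_affineSimplex (hs : Convex ℝ s) {n : ℕ} (v : Fin n → s) :
    IsConvexMap (convex_stdSimplex ℝ (Fin n)) hs (affineSimplex hs v) := by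
  intro k w t
  ext
  simp only [coe_affineSimplex, affineSimplex_stdSimplex_apply, Function.comp_apply,
    Finset.sum_smul, Finset.smul_sum, mul_smul]
  exact Finset.sum_comm

lemma affineSimplex_vertex (n : ℕ) :
    affineSimplex (convex_stdSimplex ℝ (Fin n)) stdSimplex.vertex = ContinuousMap.id _ := by
  ext t : 1
  refine DFunLike.ext _ _ fun i => ?_
  rw [affineSimplex_stdSimplex_apply]
  simp [Pi.single_apply]

lemma comp_vertex_eq (hs : Convex ℝ s) {n : ℕ} (v : Fin n → s) :
    affineSimplex hs v ∘ stdSimplex.vertex = v := by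
  funext i
  ext
  rw [Function.comp_apply, coe_affineSimplex]
  simp [Pi.single_apply, ite_smul]

end Affine

/-! ### Subdivision and the prism operator -/

section Cylinder

/-- The cylinder over a subset of a vector space, as a subset of a vector space. -/
abbrev cylinder {E : Type*} (s : Set E) : Set (E × ℝ) := s ×ˢ Set.Icc (0 : ℝ) 1

lemma convex_cylinder {E : Type*} [AddCommGroup E] [Module ℝ E] {s : Set E}
    (hs : Convex ℝ s) : Convex ℝ (cylinder s) := hs.prod (convex_Icc 0 1)

variable {E F : Type*} [AddCommGroup E] [Module ℝ E] [TopologicalSpace E] [ContinuousAdd E]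
  [ContinuousSMul ℝ E] [AddCommGroup F] [Module ℝ F] [TopologicalSpace F] [ContinuousAdd F]
  [ContinuousSMul ℝ F] {s : Set E} {s' : Set F}

/-- The inclusion of a convex set into its cylinder at height `a`. -/
def cylinderAt (a : unitInterval) : C(s, cylinder s) where
  toFun x := ⟨(x, a), x.2, a.2⟩

/-- The map of cylinders induced by a continuous map. -/
def cylinderMap (f : C(s, s')) : C(cylinder s, cylinder s') where
  toFun p := ⟨(f ⟨p.1.1, p.2.1⟩, p.1.2), (f ⟨p.1.1, p.2.1⟩).2, p.2.2⟩

/-- The cylinder as a product space. -/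
def cylinderToProd : C(cylinder s, s × unitInterval) where
  toFun p := (⟨p.1.1, p.2.1⟩, ⟨p.1.2, p.2.2⟩)

lemma isConvexMap_cylinderAt (hs : Convex ℝ s) (a : unitInterval) :
    IsConvexMap hs (convex_cylinder hs) (cylinderAt a) := by
  intro n v t
  apply Subtype.ext
  rw [coe_affineSimplex]
  refine Prod.ext ?_ ?_
  · simp only [Prod.fst_sum]
    rfl
  · simp only [Prod.snd_sum]
    change (a : ℝ) = ∑ i, t i * (a : ℝ)
    rw [← Finset.sum_mul, stdSimplex.sum_eq_one, one_mul]

lemma isConvexMap_cylinderMap {hs : Convex ℝ s} {hs' : Convex ℝ s'} {f : C(s, s')}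
    (hf : IsConvexMap hs hs' f) :
    IsConvexMap (convex_cylinder hs) (convex_cylinder hs') (cylinderMap f) := by
  intro n v t
  have key : (⟨(affineSimplex (convex_cylinder hs) v t).1.1,
      (affineSimplex (convex_cylinder hs) v t).2.1⟩ : s) =
      affineSimplex hs (fun i => ⟨(v i).1.1, (v i).2.1⟩) t := by
    apply Subtype.ext
    change (affineSimplex (convex_cylinder hs) v t : E × ℝ).1 = _
    rw [coe_affineSimplex, coe_affineSimplex, Prod.fst_sum]
    rfl
  apply Subtype.ext
  refine Prod.ext ?_ ?_
  · change ((f ⟨_, _⟩ : s') : F) = _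
    rw [key, hf, coe_affineSimplex, coe_affineSimplex, Prod.fst_sum]
    rfl
  · change (affineSimplex (convex_cylinder hs) v t : E × ℝ).2 = _
    rw [coe_affineSimplex, coe_affineSimplex, Prod.snd_sum, Prod.snd_sum]
    rfl

/-- The prism on a chain of tuples: a chain homotopy, inside the cylinder, from the chain at the
bottom to its subdivision at the top. -/
noncomputable def TupleChain.prism (hs : Convex ℝ s) (n : ℕ) :
    TupleChain s n →ₗ[ZMod 2] TupleChain (cylinder s) (n + 1) :=
  TupleChain.homotopy (fun _ v => cylinderAt 0 (v 0)) (fun n => TupleChain.map (cylinderAt 0) n)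
    (fun n => TupleChain.map (cylinderAt 1) n ∘ₗ TupleChain.subdiv (tupleBarycenter hs) n) n

lemma TupleChain.bdry_prism (hs : Convex ℝ s) (n : ℕ) (c : TupleChain s (n + 1)) :
    TupleChain.bdry (n + 1) (TupleChain.prism hs (n + 1) c) =
      TupleChain.map (cylinderAt 0) (n + 1) c +
      TupleChain.map (cylinderAt 1) (n + 1) (TupleChain.subdiv (tupleBarycenter hs) (n + 1) c) +
      TupleChain.prism hs n (TupleChain.bdry n c) := by
  refine TupleChain.bdry_homotopy (fun n c => TupleChain.bdry_map _ _ _) (fun n c => ?_) ?_ n c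
  · rw [LinearMap.comp_apply, LinearMap.comp_apply, TupleChain.bdry_map, TupleChain.bdry_subdiv]
  · refine LinearMap.ext fun c => TupleChain.ext_single (fun v => ?_) c
    rw [LinearMap.comp_apply, TupleChain.subdiv, LinearMap.id_apply, TupleChain.map_single,
      TupleChain.map_single, Subsingleton.elim ((cylinderAt 0 : s → cylinder s) ∘ v)]

lemma TupleChain.map_prism {hs : Convex ℝ s} {hs' : Convex ℝ s'} {f : C(s, s')}
    (hf : IsConvexMap hs hs' f) (n : ℕ) (c : TupleChain s n) :
    TupleChain.map (cylinderMap f) (n + 1) (TupleChain.prism hs n c) =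
      TupleChain.prism hs' n (TupleChain.map f n c) := by
  have comm (a : unitInterval) (n : ℕ) (c : TupleChain s n) :
      TupleChain.map (cylinderMap f) n (TupleChain.map (cylinderAt a) n c) =
        TupleChain.map (cylinderAt a) n (TupleChain.map f n c) :=
    TupleChain.ext_single
      (f := TupleChain.map (cylinderMap f) n ∘ₗ TupleChain.map (cylinderAt a) n)
      (g := TupleChain.map (cylinderAt a) n ∘ₗ TupleChain.map f n)
      (fun v => by simp only [LinearMap.comp_apply, TupleChain.map_single]; rfl) c
  refine TupleChain.map_homotopy (fun n v => rfl) (comm 0) (fun n c => ?_) n c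
  rw [LinearMap.comp_apply, LinearMap.comp_apply, comm,
    TupleChain.map_subdiv hf.map_tupleBarycenter]

end Cylinder

namespace SingChain

variable {X Y Z : Type*} [TopologicalSpace X] [TopologicalSpace Y] [TopologicalSpace Z]
variable {E : Type*} [AddCommGroup E] [Module ℝ E] [TopologicalSpace E] [ContinuousAdd E]
  [ContinuousSMul ℝ E] {s : Set E}

/-- The identity of the standard simplex is affine, so that operators on tuples can be transported
to every singular simplex. -/
lemma realize_vertex (n : ℕ) :
    realize (convex_stdSimplex ℝ (Fin n)) n (Finsupp.single stdSimplex.vertex 1) =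
      Finsupp.single (ContinuousMap.id _) 1 := by
  rw [realize_single, affineSimplex_vertex]

/-- Barycentric subdivision of singular chains. -/
noncomputable def subdiv (n : ℕ) : SingChain X n →ₗ[ZMod 2] SingChain X n :=
  Finsupp.linearCombination (ZMod 2) fun σ => map σ n (realize (convex_stdSimplex ℝ (Fin n)) n
    (TupleChain.subdiv (tupleBarycenter (convex_stdSimplex ℝ (Fin n))) n
      (Finsupp.single stdSimplex.vertex 1)))

lemma subdiv_single (n : ℕ) (σ : C(stdSimplex ℝ (Fin n), X)) :
    subdiv n (Finsupp.single σ 1) = map σ n (realize (convex_stdSimplex ℝ (Fin n)) n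
      (TupleChain.subdiv (tupleBarycenter (convex_stdSimplex ℝ (Fin n))) n
        (Finsupp.single stdSimplex.vertex 1))) := by
  rw [subdiv, Finsupp.linearCombination_single, one_smul]

lemma map_subdiv (f : C(X, Y)) (n : ℕ) (c : SingChain X n) :
    map f n (subdiv n c) = subdiv n (map f n c) :=
  ext_single (f := map f n ∘ₗ subdiv n) (g := subdiv n ∘ₗ map f n)
    (fun σ => by simp only [LinearMap.comp_apply, map_single, subdiv_single, map_map]) c

lemma subdiv_realize (hs : Convex ℝ s) (n : ℕ) (c : TupleChain s n) :
    subdiv n (realize hs n c) = realize hs n (TupleChain.subdiv (tupleBarycenter hs) n c) := by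
  refine TupleChain.ext_single (f := subdiv n ∘ₗ realize hs n)
    (g := realize hs n ∘ₗ TupleChain.subdiv (tupleBarycenter hs) n) (fun v => ?_) c
  have hv := isConvexMap_affineSimplex hs v
  rw [LinearMap.comp_apply, LinearMap.comp_apply, realize_single, subdiv_single,
    map_realize _ hs hv, TupleChain.map_subdiv hv.map_tupleBarycenter, TupleChain.map_single,
    comp_vertex_eq]

lemma bdry_subdiv (n : ℕ) (c : SingChain X (n + 1)) :
    bdry n (subdiv (n + 1) c) = subdiv n (bdry n c) := by
  refine ext_single (f := bdry n ∘ₗ subdiv (n + 1)) (g := subdiv n ∘ₗ bdry n) (fun σ => ?_) c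
  rw [LinearMap.comp_apply, LinearMap.comp_apply, subdiv_single, bdry_map, bdry_realize,
    TupleChain.bdry_subdiv, ← subdiv_realize, map_subdiv, ← bdry_realize, realize_vertex,
    ← bdry_map, map_single, ContinuousMap.comp_id]

lemma subdiv_mem {A : Set X} {n : ℕ} {c : SingChain X n} (hc : c ∈ within A n) :
    subdiv n c ∈ within A n := by
  refine map_within_le (fun σ hσ => ?_) hc
  rw [subdiv_single]
  exact within_mono hσ n (map_mem_range σ _)

/-- The inclusion `x ↦ (x, a)`. -/
def slice (a : unitInterval) : C(X, X × unitInterval) := ⟨fun x => (x, a), by fun_prop⟩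

/-- The prism operator: a natural chain homotopy in `X × I` from a chain at the bottom to its
subdivision at the top. -/
noncomputable def prism (n : ℕ) : SingChain X n →ₗ[ZMod 2] SingChain (X × unitInterval) (n + 1) :=
  Finsupp.linearCombination (ZMod 2) fun σ => map (σ.prodMap (ContinuousMap.id _)) (n + 1)
    (map cylinderToProd (n + 1) (realize (convex_cylinder (convex_stdSimplex ℝ (Fin n))) (n + 1)
      (TupleChain.prism (convex_stdSimplex ℝ (Fin n)) n (Finsupp.single stdSimplex.vertex 1))))

lemma prism_single (n : ℕ) (σ : C(stdSimplex ℝ (Fin n), X)) :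
    prism n (Finsupp.single σ 1) = map (σ.prodMap (ContinuousMap.id _)) (n + 1)
    (map cylinderToProd (n + 1) (realize (convex_cylinder (convex_stdSimplex ℝ (Fin n))) (n + 1)
      (TupleChain.prism (convex_stdSimplex ℝ (Fin n)) n (Finsupp.single stdSimplex.vertex 1)))) := by
  rw [prism, Finsupp.linearCombination_single, one_smul]

lemma map_prism (f : C(X, Y)) (n : ℕ) (c : SingChain X n) :
    map (f.prodMap (ContinuousMap.id _)) (n + 1) (prism n c) = prism n (map f n c) :=
  ext_single (f := map (f.prodMap (ContinuousMap.id _)) (n + 1) ∘ₗ prism n)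
    (g := prism n ∘ₗ map f n)
    (fun σ => by
      simp only [LinearMap.comp_apply, map_single, prism_single, map_map]
      rfl) c

lemma prism_realize (hs : Convex ℝ s) (n : ℕ) (c : TupleChain s n) :
    prism n (realize hs n c) = map cylinderToProd (n + 1)
      (realize (convex_cylinder hs) (n + 1) (TupleChain.prism hs n c)) := by
  refine TupleChain.ext_single (f := prism n ∘ₗ realize hs n)
    (g := map cylinderToProd (n + 1) ∘ₗ realize (convex_cylinder hs) (n + 1) ∘ₗ
      TupleChain.prism hs n) (fun v => ?_) c
  have hv := isConvexMap_affineSimplex hs v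
  have h := TupleChain.map_prism hv n (Finsupp.single stdSimplex.vertex 1)
  rw [TupleChain.map_single, comp_vertex_eq] at h
  rw [LinearMap.comp_apply, LinearMap.comp_apply, LinearMap.comp_apply, realize_single,
    prism_single, ← h, ← map_realize _ _ (isConvexMap_cylinderMap hv), map_map, map_map]
  rfl

lemma bdry_prism (n : ℕ) (c : SingChain X (n + 1)) :
    bdry (n + 1) (prism (n + 1) c) = map (slice 0) (n + 1) c +
      map (slice 1) (n + 1) (subdiv (n + 1) c) + prism n (bdry n c) := by
  refine ext_single (f := bdry (n + 1) ∘ₗ prism (n + 1)) (g := map (slice 0) (n + 1) +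
    map (slice 1) (n + 1) ∘ₗ subdiv (n + 1) + prism n ∘ₗ bdry n) (fun σ => ?_) c
  simp only [LinearMap.comp_apply, LinearMap.add_apply]
  rw [prism_single, bdry_map, bdry_map, bdry_realize, TupleChain.bdry_prism]
  simp only [map_add]
  congr 1
  · congr 1
    · rw [← map_realize _ _ (isConvexMap_cylinderAt (convex_stdSimplex ℝ (Fin (n + 1))) 0),
        realize_vertex, map_single, map_single,
        map_single, map_single]
      rfl
    · rw [← map_realize _ _ (isConvexMap_cylinderAt (convex_stdSimplex ℝ (Fin (n + 1))) 1),
        map_map, map_map, subdiv_single, map_map]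
      rfl
  · rw [← prism_realize, map_prism, ← bdry_realize, realize_vertex, ← bdry_map, map_single,
      ContinuousMap.comp_id]

lemma prism_mem {A : Set X} {n : ℕ} {c : SingChain X n} (hc : c ∈ within A n) :
    prism n c ∈ within (A ×ˢ Set.univ) (n + 1) := by
  refine map_within_le (fun σ hσ => ?_) hc
  rw [prism_single]
  refine within_mono ?_ _ (map_mem_range _ _)
  rintro _ ⟨p, rfl⟩
  exact ⟨hσ ⟨p.1, rfl⟩, Set.mem_univ _⟩

/-- The chain homotopy between a chain and its subdivision. -/
noncomputable def subdivHomotopy (n : ℕ) : SingChain X n →ₗ[ZMod 2] SingChain X (n + 1) :=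
  map ContinuousMap.fst (n + 1) ∘ₗ prism n

lemma bdry_subdivHomotopy (n : ℕ) (c : SingChain X (n + 1)) :
    bdry (n + 1) (subdivHomotopy (n + 1) c) =
      c + subdiv (n + 1) c + subdivHomotopy n (bdry n c) := by
  rw [subdivHomotopy, LinearMap.comp_apply, bdry_map, bdry_prism, map_add, map_add, map_map,
    map_map]
  congr 1
  exact congrArg₂ _ (map_id _ _) (map_id _ _)

lemma subdivHomotopy_mem {A : Set X} {n : ℕ} {c : SingChain X n} (hc : c ∈ within A n) :
    subdivHomotopy n c ∈ within A (n + 1) :=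
  map_mem (fun p (hp : p ∈ A ×ˢ Set.univ) => hp.1) (prism_mem hc)

lemma bdry_bdry (n : ℕ) (c : SingChain X (n + 2)) : bdry n (bdry (n + 1) c) = 0 := by
  refine ext_single (f := bdry n ∘ₗ bdry (n + 1)) (g := 0) (fun σ => ?_) c
  rw [LinearMap.comp_apply, ← ContinuousMap.comp_id σ, ← map_single, ← realize_vertex, bdry_map,
    bdry_map, bdry_realize, bdry_realize, TupleChain.bdry_bdry]
  simp

end SingChain

/-! ### Small simplices -/

section Small

variable {E : Type*} [NormedAddCommGroup E] [NormedSpace ℝ E] {s : Set E}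

/-- Chains of tuples whose vertices have pairwise distances at most `δ`. -/
noncomputable def TupleChain.small (s : Set E) (δ : ℝ) (n : ℕ) :
    Submodule (ZMod 2) (TupleChain s n) :=
  Finsupp.supported (ZMod 2) (ZMod 2) {w | ∀ i j, dist (w i : E) (w j) ≤ δ}

lemma dist_tupleBarycenter_le (hs : Convex ℝ s) {n : ℕ} {v : Fin (n + 1) → s} {δ : ℝ}
    (hv : ∀ i j, dist (v i : E) (v j) ≤ δ) (i : Fin (n + 1)) :
    dist (v i : E) (tupleBarycenter hs n v) ≤ n / (n + 1) * δ := by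
  have hb : ((tupleBarycenter hs n v : s) : E) = ∑ j, ((n : ℝ) + 1)⁻¹ • (v j : E) := by
    rw [tupleBarycenter, coe_affineSimplex]
    refine Finset.sum_congr rfl fun j _ => ?_
    have : (stdSimplex.barycenter : stdSimplex ℝ (Fin (n + 1))) j = ((n : ℝ) + 1)⁻¹ :=
      (stdSimplex.barycenter_apply j).trans (by simp)
    rw [this]
  have hn : (n : ℝ) + 1 ≠ 0 := by positivity
  have hvi : (v i : E) = ∑ _j : Fin (n + 1), ((n : ℝ) + 1)⁻¹ • (v i : E) := by
    rw [Finset.sum_const, Finset.card_univ, Fintype.card_fin, ← Nat.cast_smul_eq_nsmul ℝ, smul_smul]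
    push_cast
    rw [mul_inv_cancel₀ hn, one_smul]
  rw [hb, dist_eq_norm, hvi, ← Finset.sum_sub_distrib, Fin.sum_univ_succAbove _ i, sub_self,
    zero_add]
  refine (norm_sum_le_of_le _ (f := fun j => ((n : ℝ) + 1)⁻¹ • (v i : E) -
    ((n : ℝ) + 1)⁻¹ • (v (i.succAbove j) : E)) (n := fun _ => ((n : ℝ) + 1)⁻¹ * δ)
    fun j _ => ?_).trans ?_
  · rw [← smul_sub, norm_smul, Real.norm_of_nonneg (by positivity), ← dist_eq_norm]
    exact mul_le_mul_of_nonneg_left (hv _ _) (by positivity)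
  · rw [Finset.sum_const, Finset.card_univ, Fintype.card_fin, nsmul_eq_mul, div_eq_mul_inv,
      mul_assoc]

/-- Subdividing an `n`-simplex shrinks distances of vertices by the factor `n / (n + 1)`. The
statement about convex hulls is needed for the induction. -/
lemma TupleChain.subdiv_single_mem (hs : Convex ℝ s) (n : ℕ) {v : Fin (n + 1) → s} {δ : ℝ}
    (hδ : 0 ≤ δ) (hv : ∀ i j, dist (v i : E) (v j) ≤ δ) :
    TupleChain.subdiv (tupleBarycenter hs) (n + 1) (Finsupp.single v 1) ∈
      Finsupp.supported (ZMod 2) (ZMod 2) {w : Fin (n + 1) → s |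
        (∀ i j, dist (w i : E) (w j) ≤ n / (n + 1) * δ) ∧
        ∀ i, (w i : E) ∈ convexHull ℝ (Set.range fun i => (v i : E))} := by
  have hr : (0 : ℝ) ≤ n / (n + 1) * δ := by positivity
  have hb : ((tupleBarycenter hs n v : s) : E) ∈ convexHull ℝ (Set.range fun i => (v i : E)) := by
    rw [tupleBarycenter, coe_affineSimplex]
    exact (convex_convexHull ℝ _).sum_mem (fun i _ => stdSimplex.zero_le _ i)
      (stdSimplex.sum_eq_one _) fun i _ => subset_convexHull ℝ _ ⟨i, rfl⟩
  have hball : ∀ x ∈ convexHull ℝ (Set.range fun i => (v i : E)),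
      dist x (tupleBarycenter hs n v) ≤ n / (n + 1) * δ := by
    refine convexHull_min (t := Metric.closedBall _ _) ?_ (convex_closedBall _ _)
    rintro _ ⟨i, rfl⟩
    exact dist_tupleBarycenter_le hs hv i
  suffices h : TupleChain.subdiv (tupleBarycenter hs) n (TupleChain.bdry n (Finsupp.single v 1)) ∈
      Finsupp.supported (ZMod 2) (ZMod 2) {w : Fin n → s |
        (∀ i j, dist (w i : E) (w j) ≤ n / (n + 1) * δ) ∧
        ∀ i, (w i : E) ∈ convexHull ℝ (Set.range fun i => (v i : E))} by
    rw [TupleChain.subdiv_single]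
    have hle : Finsupp.supported (ZMod 2) (ZMod 2) {w : Fin n → s |
        (∀ i j, dist (w i : E) (w j) ≤ n / (n + 1) * δ) ∧
        ∀ i, (w i : E) ∈ convexHull ℝ (Set.range fun i => (v i : E))} ≤
        (Finsupp.supported (ZMod 2) (ZMod 2) {w : Fin (n + 1) → s |
        (∀ i j, dist (w i : E) (w j) ≤ n / (n + 1) * δ) ∧
        ∀ i, (w i : E) ∈ convexHull ℝ (Set.range fun i => (v i : E))}).comap
          (TupleChain.cone (tupleBarycenter hs n v) n) := by
      rw [Finsupp.supported_eq_span_single, Submodule.span_le]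
      rintro _ ⟨w, ⟨hw1, hw2⟩, rfl⟩
      simp only [SetLike.mem_coe, Submodule.mem_comap, TupleChain.cone_single]
      refine Finsupp.single_mem_supported _ _ ⟨fun i j => ?_, fun i => ?_⟩
      · refine Fin.cases ?_ (fun i => ?_) i <;> refine Fin.cases ?_ (fun j => ?_) j
        · simpa using hr
        · simpa [dist_comm] using hball _ (hw2 j)
        · simpa using hball _ (hw2 i)
        · simpa using hw1 i j
      · refine Fin.cases ?_ (fun i => ?_) i
        · simpa using hb
        · simpa using hw2 i
    exact hle h
  cases n with
  | zero =>
    refine (Finsupp.mem_supported _ _).2 fun w _ => ⟨fun i => i.elim0, fun i => i.elim0⟩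
  | succ n =>
    rw [TupleChain.bdry_single, map_sum]
    refine Submodule.sum_mem _ fun k _ => ?_
    refine Finsupp.supported_mono ?_ (subdiv_single_mem hs n hδ (v := v ∘ k.succAbove)
      (fun i j => hv _ _))
    rintro w ⟨hw1, hw2⟩
    refine ⟨fun i j => (hw1 i j).trans (mul_le_mul_of_nonneg_right ?_ hδ),
      fun i => convexHull_mono ?_ (hw2 i)⟩
    · rw [div_le_div_iff₀ (by positivity) (by positivity)]
      push_cast
      nlinarith
    · rintro _ ⟨i, rfl⟩
      exact ⟨_, rfl⟩

lemma TupleChain.subdiv_iterate_mem_small (hs : Convex ℝ s) (n : ℕ) {δ : ℝ} (hδ : 0 ≤ δ)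
    {c : TupleChain s (n + 1)} (hc : c ∈ TupleChain.small s δ (n + 1)) (k : ℕ) :
    (TupleChain.subdiv (tupleBarycenter hs) (n + 1))^[k] c ∈
      TupleChain.small s ((n / (n + 1) : ℝ) ^ k * δ) (n + 1) := by
  induction k with
  | zero => simpa using hc
  | succ k ih =>
    rw [Function.iterate_succ_apply']
    have hle : TupleChain.small s ((n / (n + 1) : ℝ) ^ k * δ) (n + 1) ≤
        (TupleChain.small s ((n / (n + 1) : ℝ) ^ (k + 1) * δ) (n + 1)).comap
          (TupleChain.subdiv (tupleBarycenter hs) (n + 1)) := by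
      rw [TupleChain.small, Finsupp.supported_eq_span_single, Submodule.span_le]
      rintro _ ⟨v, hv, rfl⟩
      refine Finsupp.supported_mono ?_ (TupleChain.subdiv_single_mem hs n (by positivity) hv)
      rintro w ⟨hw, -⟩
      rw [pow_succ', mul_assoc]
      exact hw
    exact hle ih

lemma range_affineSimplex_subset (hs : Convex ℝ s) {n : ℕ} {w : Fin (n + 1) → s} {δ : ℝ}
    (hw : ∀ i j, dist (w i : E) (w j) ≤ δ) :
    Set.range (affineSimplex hs w) ⊆ Metric.closedBall (w 0) δ := by
  rintro _ ⟨t, rfl⟩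
  rw [Metric.mem_closedBall, Subtype.dist_eq, coe_affineSimplex]
  have h := (convex_closedBall (w 0 : E) δ).sum_mem (t := Finset.univ) (w := t)
    (z := fun i => (w i : E)) (fun i _ => stdSimplex.zero_le _ i) (stdSimplex.sum_eq_one t)
    (fun i _ => hw i 0)
  exact h

end Small

namespace SingChain

variable {X : Type*} [TopologicalSpace X]

lemma subdiv_iterate_single (n k : ℕ) (σ : C(stdSimplex ℝ (Fin n), X)) :
    (subdiv n)^[k] (Finsupp.single σ 1) = map σ n (realize (convex_stdSimplex ℝ (Fin n)) n
      ((TupleChain.subdiv (tupleBarycenter (convex_stdSimplex ℝ (Fin n))) n)^[k]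
        (Finsupp.single stdSimplex.vertex 1))) := by
  induction k with
  | zero => simp [affineSimplex_vertex]
  | succ k ih =>
    rw [Function.iterate_succ_apply', ih, Function.iterate_succ_apply', ← subdiv_realize,
      map_subdiv]

/-- A singular simplex in a union of two open sets becomes small after enough subdivisions. -/
lemma exists_subdiv_iterate_single_mem {U V : Set X} (hU : IsOpen U) (hV : IsOpen V) {n : ℕ}
    {σ : C(stdSimplex ℝ (Fin (n + 1)), X)} (hσ : Set.range σ ⊆ U ∪ V) :
    ∃ k, (subdiv (n + 1))^[k] (Finsupp.single σ 1) ∈ within U (n + 1) ⊔ within V (n + 1) := by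
  obtain ⟨ε, hε, hball⟩ := lebesgue_number_lemma_of_metric
    (isCompact_univ (X := stdSimplex ℝ (Fin (n + 1))))
    (c := fun b : Bool => σ ⁻¹' (if b then U else V))
    (fun b => (by cases b <;> simpa : IsOpen (if b then U else V)).preimage σ.continuous)
    (fun t _ => by
      rcases hσ ⟨t, rfl⟩ with h | h
      · exact Set.mem_iUnion.2 ⟨true, by simpa using h⟩
      · exact Set.mem_iUnion.2 ⟨false, by simpa using h⟩)
  obtain ⟨k, hk⟩ := exists_pow_lt_of_lt_one hε
    (show (n / (n + 1) : ℝ) < 1 by rw [div_lt_one (by positivity)]; linarith)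
  refine ⟨k, ?_⟩
  have h0 : (Finsupp.single stdSimplex.vertex 1 :
      TupleChain (stdSimplex ℝ (Fin (n + 1))) (n + 1)) ∈ TupleChain.small _ 1 (n + 1) := by
    refine Finsupp.single_mem_supported _ _ fun i j => ?_
    exact (Metric.dist_le_diam_of_mem (bounded_stdSimplex _) (Subtype.prop _) (Subtype.prop _)).trans
      diam_stdSimplex_le
  have h1 := TupleChain.subdiv_iterate_mem_small (convex_stdSimplex ℝ (Fin (n + 1))) n zero_le_one
    h0 k
  rw [subdiv_iterate_single]
  have hle : TupleChain.small (stdSimplex ℝ (Fin (n + 1))) ((n / (n + 1) : ℝ) ^ k * 1) (n + 1) ≤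
      (within U (n + 1) ⊔ within V (n + 1)).comap
        (map σ (n + 1) ∘ₗ realize (convex_stdSimplex ℝ (Fin (n + 1))) (n + 1)) := by
    rw [TupleChain.small, Finsupp.supported_eq_span_single, Submodule.span_le]
    rintro _ ⟨w, hw, rfl⟩
    simp only [SetLike.mem_coe, Submodule.mem_comap, LinearMap.comp_apply, realize_single,
      map_single]
    obtain ⟨b, hb⟩ := hball (w 0) (Set.mem_univ _)
    have hr : Set.range (σ.comp (affineSimplex (convex_stdSimplex ℝ (Fin (n + 1))) w)) ⊆
        if b then U else V := by
      rintro _ ⟨t, rfl⟩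
      exact hb (Metric.closedBall_subset_ball (by linarith)
        (range_affineSimplex_subset (convex_stdSimplex ℝ (Fin (n + 1))) hw ⟨t, rfl⟩))
    cases b with
    | true => exact Submodule.mem_sup_left (single_mem_within (by simpa using hr) _)
    | false => exact Submodule.mem_sup_right (single_mem_within (by simpa using hr) _)
  exact hle h1

lemma subdiv_iterate_mem_sup {U V : Set X} {n : ℕ} (k : ℕ) {c : SingChain X n}
    (hc : c ∈ within U n ⊔ within V n) : (subdiv n)^[k] c ∈ within U n ⊔ within V n := by
  induction k with
  | zero => exact hc
  | succ k ih =>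
    rw [Function.iterate_succ_apply']
    obtain ⟨a, ha, b, hb, hab⟩ := Submodule.mem_sup.1 ih
    rw [← hab, map_add]
    exact Submodule.add_mem_sup (subdiv_mem ha) (subdiv_mem hb)

lemma exists_subdiv_iterate_mem {U V : Set X} (hU : IsOpen U) (hV : IsOpen V) {n : ℕ}
    {c : SingChain X (n + 1)} (hc : c ∈ within (U ∪ V) (n + 1)) :
    ∃ k, (subdiv (n + 1))^[k] c ∈ within U (n + 1) ⊔ within V (n + 1) := by
  let p : Submodule (ZMod 2) (SingChain X (n + 1)) :=
    { carrier := {c | ∃ k, (subdiv (n + 1))^[k] c ∈ within U (n + 1) ⊔ within V (n + 1)}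
      zero_mem' := ⟨0, Submodule.zero_mem _⟩
      add_mem' := by
        rintro a b ⟨k, hk⟩ ⟨l, hl⟩
        refine ⟨k + l, ?_⟩
        rw [iterate_map_add]
        refine Submodule.add_mem _ ?_ ?_
        · rw [add_comm k l, Function.iterate_add_apply]
          exact subdiv_iterate_mem_sup _ hk
        · rw [Function.iterate_add_apply]
          exact subdiv_iterate_mem_sup _ hl
      smul_mem' := by
        rintro a b ⟨k, hk⟩
        refine ⟨k, ?_⟩
        have : (subdiv (n + 1))^[k] (a • b) = a • (subdiv (n + 1))^[k] b := by
          rw [← Module.End.pow_apply, map_smul, Module.End.pow_apply]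
        rw [this]
        exact Submodule.smul_mem _ _ hk }
  exact map_within_le (f := LinearMap.id) (p := p)
    (fun σ hσ => exists_subdiv_iterate_single_mem hU hV hσ) hc

/-- The small simplices theorem for two open sets: the inclusion of the sum of the two subcomplexes
into the chains of the union has acyclic cokernel. -/
theorem exists_add_bdry_mem_sup {U V : Set X} (hU : IsOpen U) (hV : IsOpen V) {n : ℕ}
    {z : SingChain X (n + 1)} (hz : z ∈ within (U ∪ V) (n + 1))
    (hdz : bdry n z ∈ within U n ⊔ within V n) :
    ∃ y ∈ within (U ∪ V) (n + 2), z + bdry (n + 1) y ∈ within U (n + 1) ⊔ within V (n + 1) := by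
  obtain ⟨k, hk⟩ := exists_subdiv_iterate_mem hU hV hz
  induction k generalizing z with
  | zero => exact ⟨0, Submodule.zero_mem _, by simpa using hk⟩
  | succ k ih =>
    rw [Function.iterate_succ_apply] at hk
    have hd : bdry n (subdiv (n + 1) z) ∈ within U n ⊔ within V n := by
      rw [bdry_subdiv]
      exact subdiv_iterate_mem_sup 1 hdz
    obtain ⟨y, hy, hzy⟩ := ih (subdiv_mem hz) hd hk
    refine ⟨subdivHomotopy (n + 1) z + y, Submodule.add_mem _ (subdivHomotopy_mem hz) hy, ?_⟩
    have : z + bdry (n + 1) (subdivHomotopy (n + 1) z + y) =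
        (subdiv (n + 1) z + bdry (n + 1) y) + subdivHomotopy n (bdry n z) := by
      rw [map_add, bdry_subdivHomotopy]
      have := ZModModule.add_self z
      grind
    rw [this]
    refine Submodule.add_mem _ hzy ?_
    obtain ⟨a, ha, b, hb, hab⟩ := Submodule.mem_sup.1 hdz
    rw [← hab, map_add]
    exact Submodule.add_mem_sup (subdivHomotopy_mem ha) (subdivHomotopy_mem hb)

end SingChain

/-! ### Relative homology classes -/

section Quotient

variable {M M' : Type*} [AddCommGroup M] [Module (ZMod 2) M] [AddCommGroup M'] [Module (ZMod 2) M']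

/-- The image of `Z` in the quotient by `N` has exactly two elements. -/
def HasTwoClasses (Z N : Submodule (ZMod 2) M) : Prop :=
  ∃ z ∈ Z, z ∉ N ∧ ∀ c ∈ Z, c ∈ N ∨ c + z ∈ N

/-- The images of `Z` in the quotient by `N` and of `Z'` in the quotient by `N'` correspond under an
additive relation. This is a way to state an isomorphism of homology groups which needs no choice
of a well-defined map. -/
def SameClasses (Z N : Submodule (ZMod 2) M) (Z' N' : Submodule (ZMod 2) M') : Prop :=
  ∃ r : M → M' → Prop, (∀ a a' b b', r a a' → r b b' → r (a + b) (a' + b')) ∧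
    (∀ c ∈ Z, ∃ c' ∈ Z', r c c') ∧ (∀ c' ∈ Z', ∃ c ∈ Z, r c c') ∧
    ∀ c ∈ Z, ∀ c' ∈ Z', r c c' → (c ∈ N ↔ c' ∈ N')

variable {Z N : Submodule (ZMod 2) M} {Z' N' : Submodule (ZMod 2) M'}

lemma SameClasses.symm (h : SameClasses Z N Z' N') : SameClasses Z' N' Z N := by
  obtain ⟨r, h1, h2, h3, h4⟩ := h
  exact ⟨fun a b => r b a, fun a a' b b' h h' => h1 _ _ _ _ h h', h3, h2,
    fun c hc c' hc' h => (h4 c' hc' c hc h).symm⟩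

lemma SameClasses.le (h : SameClasses Z N Z' N') (hZ : Z ≤ N) : Z' ≤ N' := by
  obtain ⟨r, h1, h2, h3, h4⟩ := h
  intro c' hc'
  obtain ⟨c, hc, hr⟩ := h3 c' hc'
  exact (h4 c hc c' hc' hr).1 (hZ hc)

lemma SameClasses.hasTwoClasses (h : SameClasses Z N Z' N') (hZ : HasTwoClasses Z N) :
    HasTwoClasses Z' N' := by
  obtain ⟨r, h1, h2, h3, h4⟩ := h
  obtain ⟨z, hz, hzN, hall⟩ := hZ
  obtain ⟨z', hz', hr⟩ := h2 z hz
  refine ⟨z', hz', fun h => hzN ((h4 z hz z' hz' hr).2 h), fun c' hc' => ?_⟩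
  obtain ⟨c, hc, hrc⟩ := h3 c' hc'
  exact (hall c hc).imp (h4 c hc c' hc' hrc).1
    (h4 _ (Z.add_mem hc hz) _ (Z'.add_mem hc' hz') (h1 _ _ _ _ hrc hr)).1

lemma sameClasses_of_linearMap (f : M →ₗ[ZMod 2] M') (hZ : ∀ c ∈ Z, f c ∈ Z')
    (hN : ∀ c ∈ Z, f c ∈ N' ↔ c ∈ N) (hsurj : ∀ c' ∈ Z', ∃ c ∈ Z, c' + f c ∈ N') :
    SameClasses Z N Z' N' := by
  refine ⟨fun c c' => c' + f c ∈ N', fun a a' b b' h h' => ?_, fun c hc => ⟨f c, hZ c hc, ?_⟩,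
    hsurj, fun c hc c' _ h => ?_⟩
  · change a' + b' + f (a + b) ∈ N'
    rw [map_add]
    convert N'.add_mem h h' using 1
    abel
  · change f c + f c ∈ N'
    rw [ZModModule.add_self]
    exact N'.zero_mem
  · rw [← hN c hc]
    constructor
    · intro h2
      simpa [add_assoc, ZModModule.add_self] using N'.add_mem h h2
    · intro h2
      simpa [← add_assoc, ZModModule.add_self] using N'.add_mem h2 h

/-- An involution of a one-dimensional space over the field with two elements is the identity. -/
lemma HasTwoClasses.add_apply_mem (h : HasTwoClasses Z N) (f : M →ₗ[ZMod 2] M)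
    (hZ : ∀ c ∈ Z, f c ∈ Z) (hN : ∀ c ∈ N, f c ∈ N) (hf : ∀ c, f (f c) = c) {c : M}
    (hc : c ∈ Z) : c + f c ∈ N := by
  obtain ⟨z, hz, hzN, hall⟩ := h
  rcases hall c hc with h1 | h1
  · exact N.add_mem h1 (hN c h1)
  · rcases hall (f c) (hZ c hc) with h2 | h2
    · have h3 := hN _ h2
      rw [hf] at h3
      exact N.add_mem h3 h2
    · have := N.add_mem h1 h2
      have hzz := ZModModule.add_self z
      have e : c + f c = c + z + (f c + z) := by grind
      rwa [e]

end Quotient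

namespace SingChain

variable {X Y : Type*} [TopologicalSpace X] [TopologicalSpace Y]

/-- The relative `q`-cycles of the pair `(A, B)`, as chains in the ambient space. -/
noncomputable def relCycles (A B : Set X) (q : ℕ) : Submodule (ZMod 2) (SingChain X (q + 1)) :=
  within A (q + 1) ⊓ (within B q).comap (bdry q)

/-- The relative `q`-boundaries of the pair `(A, B)`, as chains in the ambient space. -/
noncomputable def relBoundaries (A B : Set X) (q : ℕ) : Submodule (ZMod 2) (SingChain X (q + 1)) :=
  within B (q + 1) ⊔ (within A (q + 2)).map (bdry (q + 1))

/-- The relative homology of `(A, B)` in degree `q` vanishes. -/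
def Acyclic (A B : Set X) (q : ℕ) : Prop := relCycles A B q ≤ relBoundaries A B q

/-- The relative homology of `(A, B)` in degree `q` is one-dimensional. -/
def OneDim (A B : Set X) (q : ℕ) : Prop := HasTwoClasses (relCycles A B q) (relBoundaries A B q)

/-- The relative homology groups of two pairs in two degrees correspond. -/
def SameHomology (A B : Set X) (q : ℕ) (A' B' : Set Y) (q' : ℕ) : Prop :=
  SameClasses (relCycles A B q) (relBoundaries A B q) (relCycles A' B' q') (relBoundaries A' B' q')

variable {A B A' B' O U V W : Set X} {q : ℕ}

lemma mem_relCycles {c : SingChain X (q + 1)} :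
    c ∈ relCycles A B q ↔ c ∈ within A (q + 1) ∧ bdry q c ∈ within B q := Iff.rfl

lemma mem_relBoundaries {c : SingChain X (q + 1)} :
    c ∈ relBoundaries A B q ↔
      ∃ e ∈ within A (q + 2), c + bdry (q + 1) e ∈ within B (q + 1) := by
  rw [relBoundaries, Submodule.mem_sup]
  constructor
  · rintro ⟨b, hb, _, ⟨e, he, rfl⟩, rfl⟩
    exact ⟨e, he, by simpa [add_assoc, ZModModule.add_self] using hb⟩
  · rintro ⟨e, he, h⟩
    exact ⟨_, h, _, ⟨e, he, rfl⟩, by simp [add_assoc, ZModModule.add_self]⟩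

lemma relBoundaries_mono (hA : A ⊆ A') (hB : B ⊆ B') (q : ℕ) :
    relBoundaries A B q ≤ relBoundaries A' B' q :=
  sup_le_sup (within_mono hB _) (Submodule.map_mono (within_mono hA _))

lemma relCycles_mono (hA : A ⊆ A') (hB : B ⊆ B') (q : ℕ) :
    relCycles A B q ≤ relCycles A' B' q :=
  inf_le_inf (within_mono hA _) (Submodule.comap_mono (within_mono hB _))

lemma acyclic_self (A : Set X) (q : ℕ) : Acyclic A A q :=
  fun _ hc => Submodule.mem_sup_left hc.1

lemma map_mem_relCycles {f : C(X, Y)} {A B : Set X} {A' B' : Set Y} (hA : Set.MapsTo f A A')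
    (hB : Set.MapsTo f B B') {c : SingChain X (q + 1)} (hc : c ∈ relCycles A B q) :
    map f (q + 1) c ∈ relCycles A' B' q :=
  ⟨map_mem hA hc.1, by
    rw [SetLike.mem_coe, Submodule.mem_comap, bdry_map]
    exact map_mem hB hc.2⟩

lemma map_mem_relBoundaries {f : C(X, Y)} {A B : Set X} {A' B' : Set Y} (hA : Set.MapsTo f A A')
    (hB : Set.MapsTo f B B') {c : SingChain X (q + 1)} (hc : c ∈ relBoundaries A B q) :
    map f (q + 1) c ∈ relBoundaries A' B' q := by
  obtain ⟨e, he, h⟩ := mem_relBoundaries.1 hc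
  refine mem_relBoundaries.2 ⟨map f (q + 2) e, map_mem hA he, ?_⟩
  rw [bdry_map, ← map_add]
  exact map_mem hB h

/-- Homology may be computed on the image of an embedding. -/
lemma sameHomology_image {f : C(X, Y)} (hf : Topology.IsEmbedding f) (A B : Set X) (q : ℕ) :
    SameHomology A B q (f '' A) (f '' B) q := by
  have hmem {C : Set X} {n : ℕ} {c : SingChain X n} (h : map f n c ∈ within (f '' C) n) :
      c ∈ within C n := by
    obtain ⟨c', hc', he⟩ := exists_map_eq hf h
    rwa [← map_injective hf.injective n he]
  refine sameClasses_of_linearMap (map f (q + 1))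
    (fun c hc => map_mem_relCycles (Set.mapsTo_image f A) (Set.mapsTo_image f B) hc)
    (fun c hc => ⟨fun h => ?_, map_mem_relBoundaries (Set.mapsTo_image f A)
      (Set.mapsTo_image f B)⟩) (fun c' hc' => ?_)
  · obtain ⟨e, he, h⟩ := mem_relBoundaries.1 h
    obtain ⟨e', he', rfl⟩ := exists_map_eq hf he
    rw [bdry_map, ← map_add] at h
    exact mem_relBoundaries.2 ⟨e', he', hmem h⟩
  · obtain ⟨c, hc, rfl⟩ := exists_map_eq hf hc'.1
    refine ⟨c, ⟨hc, hmem ?_⟩, ?_⟩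
    · rw [← bdry_map]
      exact hc'.2
    · rw [ZModModule.add_self]
      exact Submodule.zero_mem _

/-- Surjectivity of excision: every relative cycle of `(U ∪ V, V)` is homologous to one of
`(U, U ∩ V)`. -/
lemma exists_relCycle_excision (hU : IsOpen U) (hV : IsOpen V) {c' : SingChain X (q + 1)}
    (hc' : c' ∈ relCycles (U ∪ V) V q) :
    ∃ c ∈ relCycles U (U ∩ V) q, c' + c ∈ relBoundaries (U ∪ V) V q := by
  obtain ⟨y, hy, hcy⟩ := exists_add_bdry_mem_sup hU hV hc'.1 (Submodule.mem_sup_right hc'.2)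
  obtain ⟨a, ha, b, hb, hab⟩ := Submodule.mem_sup.1 hcy
  have h1 : bdry q a + bdry q b = bdry q c' := by
    rw [← map_add, hab, map_add, bdry_bdry, add_zero]
  refine ⟨a, ⟨ha, ?_⟩, mem_relBoundaries.2 ⟨y, hy, ?_⟩⟩
  · rw [SetLike.mem_coe, Submodule.mem_comap, within_inter]
    refine ⟨bdry_mem ha, ?_⟩
    have h2 : bdry q a = bdry q c' + bdry q b := by
      rw [← h1, add_assoc, ZModModule.add_self, add_zero]
    rw [h2]
    exact Submodule.add_mem _ hc'.2 (bdry_mem hb)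
  · have h3 : c' + a + bdry (q + 1) y = b := by
      have := ZModModule.add_self a
      grind
    change c' + a + _ ∈ _
    rw [h3]
    exact hb

/-- Excision for two open sets. -/
lemma sameHomology_excision (hU : IsOpen U) (hV : IsOpen V) (q : ℕ) :
    SameHomology U (U ∩ V) q (U ∪ V) V q := by
  refine sameClasses_of_linearMap LinearMap.id
    (fun c hc => relCycles_mono Set.subset_union_left Set.inter_subset_right q hc)
    (fun c hc => ⟨fun h => ?_, fun h =>
      relBoundaries_mono Set.subset_union_left Set.inter_subset_right q h⟩)
    (fun c' hc' => exists_relCycle_excision hU hV hc')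
  obtain ⟨e, he, h⟩ := mem_relBoundaries.1 h
  rw [LinearMap.id_apply] at h
  obtain ⟨y, hy, hey⟩ := exists_add_bdry_mem_sup hU hV he (by
    have h2 := Submodule.add_mem_sup hc.1 h
    have h3 : c + (c + bdry (q + 1) e) = bdry (q + 1) e := by
      rw [← add_assoc, ZModModule.add_self, zero_add]
    rwa [h3] at h2)
  obtain ⟨e₁, he₁, e₂, he₂, heq⟩ := Submodule.mem_sup.1 hey
  refine mem_relBoundaries.2 ⟨e₁, he₁, ?_⟩
  rw [within_inter]
  refine ⟨Submodule.add_mem _ hc.1 (bdry_mem he₁), ?_⟩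
  have h4 : bdry (q + 1) e₁ + bdry (q + 1) e₂ = bdry (q + 1) e := by
    rw [← map_add, heq, map_add, bdry_bdry, add_zero]
  have h5 : c + bdry (q + 1) e₁ = (c + bdry (q + 1) e) + bdry (q + 1) e₂ := by
    have := ZModModule.add_self (bdry (q + 1) e₂)
    rw [← h4]
    grind
  rw [h5]
  exact Submodule.add_mem _ h (bdry_mem he₂)

/-- The relative Mayer–Vietoris isomorphism: if `(O, A)` and `(O, B)` are acyclic, then the homology
of `(O, A ∩ B)` is that of `(O, A ∪ B)` one degree higher. -/
lemma sameHomology_inter_union (hA : IsOpen A) (hB : IsOpen B) (hAO : A ⊆ O) (hBO : B ⊆ O)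
    (hOA : ∀ q, Acyclic O A q) (hOB : ∀ q, Acyclic O B q) (q : ℕ) :
    SameHomology O (A ∩ B) q O (A ∪ B) (q + 1) := by
  have hABO : A ∪ B ⊆ O := Set.union_subset hAO hBO
  refine ⟨fun c c' => ∃ e ∈ within O (q + 2), ∃ u ∈ within (A ∪ B) (q + 2),
    c + bdry (q + 1) e ∈ within A (q + 1) ∧ c + bdry (q + 1) (e + c' + u) ∈ within B (q + 1),
    ?_, fun c hc => ?_, fun c' hc' => ?_, ?_⟩
  · rintro a a' b b' ⟨e, he, u, hu, h1, h2⟩ ⟨f, hf, v, hv, h3, h4⟩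
    refine ⟨e + f, Submodule.add_mem _ he hf, u + v, Submodule.add_mem _ hu hv, ?_, ?_⟩
    · convert Submodule.add_mem _ h1 h3 using 1
      rw [map_add]
      abel
    · convert Submodule.add_mem _ h2 h4 using 1
      simp only [map_add]
      abel
  · have hcA := mem_relBoundaries.1 (hOA q (relCycles_mono subset_rfl Set.inter_subset_left q hc))
    have hcB := mem_relBoundaries.1 (hOB q (relCycles_mono subset_rfl Set.inter_subset_right q hc))
    obtain ⟨e, he, h1⟩ := hcA
    obtain ⟨f, hf, h2⟩ := hcB
    refine ⟨e + f, ⟨Submodule.add_mem _ he hf, ?_⟩, e, he, 0, Submodule.zero_mem _, h1, ?_⟩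
    · rw [SetLike.mem_coe, Submodule.mem_comap]
      have h3 : bdry (q + 1) (e + f) = (c + bdry (q + 1) e) + (c + bdry (q + 1) f) := by
        have := ZModModule.add_self c
        rw [map_add]
        grind
      rw [h3]
      exact Submodule.add_mem _ (within_mono Set.subset_union_left _ h1)
        (within_mono Set.subset_union_right _ h2)
    · rw [add_zero, ← add_assoc, ZModModule.add_self, zero_add]
      exact h2
  · obtain ⟨y, hy, hcy⟩ := exists_add_bdry_mem_sup hA hB hc'.2 (by
      rw [bdry_bdry]
      exact Submodule.zero_mem _)
    obtain ⟨a, ha, b, hb, hab⟩ := Submodule.mem_sup.1 hcy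
    refine ⟨a, ⟨within_mono hAO _ ha, ?_⟩, 0, Submodule.zero_mem _, y, hy, ?_, ?_⟩
    · rw [SetLike.mem_coe, Submodule.mem_comap, within_inter]
      refine ⟨bdry_mem ha, ?_⟩
      have h1 : bdry q a + bdry q b = 0 := by
        rw [← map_add, hab, map_add, bdry_bdry, bdry_bdry, add_zero]
      have h2 : bdry q a = bdry q b := by
        have := ZModModule.add_self (bdry q b)
        grind
      rw [h2]
      exact bdry_mem hb
    · simpa using ha
    · have h3 : a + bdry (q + 1) (0 + c' + y) = b := by
        have := ZModModule.add_self a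
        rw [zero_add, map_add, ← hab]
        grind
      rw [h3]
      exact hb
  · rintro c hc c' hc' ⟨e, he, u, hu, h1, h2⟩
    constructor
    · intro hcN
      obtain ⟨f, hf, h3⟩ := mem_relBoundaries.1 hcN
      rw [within_inter] at h3
      have hcc := ZModModule.add_self c
      have hdf := ZModModule.add_self (bdry (q + 1) f)
      have heA : e + f ∈ relCycles O A (q + 1) := ⟨Submodule.add_mem _ he hf, by
        rw [SetLike.mem_coe, Submodule.mem_comap]
        have h4 : bdry (q + 1) (e + f) = (c + bdry (q + 1) e) + (c + bdry (q + 1) f) := by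
          rw [map_add]
          grind
        rw [h4]
        exact Submodule.add_mem _ h1 h3.1⟩
      have heB : e + f + c' + u ∈ relCycles O B (q + 1) :=
        ⟨Submodule.add_mem _ (Submodule.add_mem _ (Submodule.add_mem _ he hf) hc'.1)
          (within_mono hABO _ hu), by
        rw [SetLike.mem_coe, Submodule.mem_comap]
        have h4 : bdry (q + 1) (e + f + c' + u) =
            (c + bdry (q + 1) (e + c' + u)) + (c + bdry (q + 1) f) := by
          simp only [map_add]
          grind
        rw [h4]
        exact Submodule.add_mem _ h2 h3.2⟩
      obtain ⟨g, hg, h5⟩ := mem_relBoundaries.1 (hOA _ heA)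
      obtain ⟨g', hg', h6⟩ := mem_relBoundaries.1 (hOB _ heB)
      refine mem_relBoundaries.2 ⟨g + g', Submodule.add_mem _ hg hg', ?_⟩
      have h7 : c' + bdry (q + 1 + 1) (g + g') = (e + f + bdry (q + 1 + 1) g) +
          (e + f + c' + u + bdry (q + 1 + 1) g') + u := by
        have h8 := ZModModule.add_self (e + f)
        have h9 := ZModModule.add_self u
        rw [map_add]
        grind
      rw [h7]
      exact Submodule.add_mem _ (Submodule.add_mem _ (within_mono Set.subset_union_left _ h5)
        (within_mono Set.subset_union_right _ h6)) hu
    · intro hcN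
      obtain ⟨g, hg, h3⟩ := mem_relBoundaries.1 hcN
      set w := c' + bdry (q + 1 + 1) g + u with hw
      have hwm : w ∈ within (A ∪ B) (q + 2) := Submodule.add_mem _ h3 hu
      have hdw : bdry (q + 1) w = bdry (q + 1) c' + bdry (q + 1) u := by
        rw [hw, map_add, map_add, bdry_bdry, add_zero]
      have hcc := ZModModule.add_self c
      have hee := ZModModule.add_self (bdry (q + 1) e)
      have hdw' : bdry (q + 1) w = (c + bdry (q + 1) e) + (c + bdry (q + 1) (e + c' + u)) := by
        rw [hdw]
        simp only [map_add]
        grind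
      obtain ⟨y, hy, hwy⟩ := exists_add_bdry_mem_sup hA hB hwm (by
        rw [hdw']
        exact Submodule.add_mem_sup h1 h2)
      obtain ⟨w₁, hw₁, w₂, hw₂, heq⟩ := Submodule.mem_sup.1 hwy
      have h4 : bdry (q + 1) w₁ + bdry (q + 1) w₂ = bdry (q + 1) w := by
        rw [← map_add, heq, map_add, bdry_bdry, add_zero]
      refine mem_relBoundaries.2 ⟨e + w₁, Submodule.add_mem _ he (within_mono hAO _ hw₁), ?_⟩
      rw [within_inter]
      constructor
      · rw [map_add, ← add_assoc]
        exact Submodule.add_mem _ h1 (bdry_mem hw₁)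
      · have h5 : c + bdry (q + 1) (e + w₁) =
            (c + bdry (q + 1) (e + c' + u)) + bdry (q + 1) w₂ := by
          have h6 := ZModModule.add_self (bdry (q + 1) w₁)
          have h7 := ZModModule.add_self (bdry (q + 1) w₂)
          rw [hdw'] at h4
          simp only [map_add] at h4 ⊢
          grind
        rw [h5]
        exact Submodule.add_mem _ h2 (bdry_mem hw₂)

lemma acyclic_zero_of_subset (hAA' : A ⊆ A') (h : Acyclic O A 0) : Acyclic O A' 0 := by
  intro c hc
  exact relBoundaries_mono subset_rfl hAA' 0 (h ⟨hc.1, mem_within_zero A _⟩)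

/-- The pair `(X, V)` has the homology of `(X, W)` in degrees where `(V, W)` has none, provided that
the connecting homomorphism vanishes one degree lower. -/
lemma sameHomology_of_acyclic (hWV : W ⊆ V) (hVO : V ⊆ O)
    (h : Acyclic V W q) (hconn : ∀ p, p + 1 = q → ∀ c ∈ relCycles O V (p + 1),
      bdry (p + 1) c ∈ relBoundaries V W p) :
    SameHomology O W q O V q := by
  refine sameClasses_of_linearMap LinearMap.id
    (fun c hc => relCycles_mono subset_rfl hWV q hc)
    (fun c hc => ⟨fun hb => ?_, fun h => relBoundaries_mono subset_rfl hWV q h⟩) (fun c hc => ?_)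
  · obtain ⟨e, he, h1⟩ := mem_relBoundaries.1 hb
    rw [LinearMap.id_apply] at h1
    have h2 : c + bdry (q + 1) e ∈ relCycles V W q := ⟨h1, by
      rw [SetLike.mem_coe, Submodule.mem_comap, map_add, bdry_bdry, add_zero]
      exact hc.2⟩
    obtain ⟨f, hf, h3⟩ := mem_relBoundaries.1 (h h2)
    refine mem_relBoundaries.2 ⟨e + f, Submodule.add_mem _ he (within_mono hVO _ hf), ?_⟩
    rwa [map_add, ← add_assoc]
  · cases q with
    | zero =>
      refine ⟨c, ⟨hc.1, mem_within_zero W _⟩, ?_⟩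
      rw [LinearMap.id_apply, ZModModule.add_self]
      exact Submodule.zero_mem _
    | succ p =>
      obtain ⟨e, he, h1⟩ := mem_relBoundaries.1 (hconn p rfl c hc)
      refine ⟨c + e, ⟨Submodule.add_mem _ hc.1 (within_mono hVO _ he), ?_⟩, ?_⟩
      · rwa [SetLike.mem_coe, Submodule.mem_comap, map_add]
      · rw [LinearMap.id_apply, ← add_assoc, ZModModule.add_self, zero_add]
        exact Submodule.mem_sup_left he

/-- The pair `(V, W)` has the homology of `(X, W)` in degrees where `(X, V)` has none, provided that
the connecting homomorphism into this degree vanishes. -/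
lemma sameHomology_of_acyclic' (hWV : W ⊆ V) (hVO : V ⊆ O)
    (h : Acyclic O V q) (hconn : ∀ c ∈ relCycles O V (q + 1),
      bdry (q + 1) c ∈ relBoundaries V W q) :
    SameHomology V W q O W q := by
  refine sameClasses_of_linearMap LinearMap.id
    (fun c hc => relCycles_mono hVO subset_rfl q hc)
    (fun c hc => ⟨fun hb => ?_, fun h => relBoundaries_mono hVO subset_rfl q h⟩) (fun c hc => ?_)
  · obtain ⟨e, he, h1⟩ := mem_relBoundaries.1 hb
    rw [LinearMap.id_apply] at h1
    have h2 : e ∈ relCycles O V (q + 1) := ⟨he, by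
      rw [SetLike.mem_coe, Submodule.mem_comap]
      have h3 : bdry (q + 1) e = c + (c + bdry (q + 1) e) := by
        rw [← add_assoc, ZModModule.add_self, zero_add]
      rw [h3]
      exact Submodule.add_mem _ hc.1 (within_mono hWV _ h1)⟩
    have h3 : c + bdry (q + 1) e ∈ relBoundaries V W q := Submodule.mem_sup_left h1
    have h4 := Submodule.add_mem _ h3 (hconn e h2)
    rwa [add_assoc, ZModModule.add_self, add_zero] at h4
  · obtain ⟨e, he, h1⟩ := mem_relBoundaries.1 (h (relCycles_mono subset_rfl hWV q hc))
    refine ⟨c + bdry (q + 1) e, ⟨h1, ?_⟩, ?_⟩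
    · rw [SetLike.mem_coe, Submodule.mem_comap, map_add, bdry_bdry, add_zero]
      exact hc.2
    · rw [LinearMap.id_apply, ← add_assoc, ZModModule.add_self, zero_add]
      exact Submodule.mem_sup_right ⟨e, he, rfl⟩

end SingChain

/-! ### Deformations and complements of coordinate subspaces -/

namespace SingChain

/-- If `A` deforms into `B` within `A`, keeping `B` in `B`, then `(A, B)` is acyclic. -/
lemma acyclic_of_homotopy {X : Type*} [TopologicalSpace X] {A B : Set X} (hBA : B ⊆ A)
    (h : C(A × unitInterval, X)) (h0 : ∀ a, h (a, 0) = a) (hA : ∀ p, h p ∈ A)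
    (h1 : ∀ a, h (a, 1) ∈ B) (hB : ∀ (a : A) (t : unitInterval), (a : X) ∈ B → h (a, t) ∈ B)
    (q : ℕ) : Acyclic A B q := by
  intro c hc
  let ι : C(A, X) := ⟨Subtype.val, continuous_subtype_val⟩
  have hι : Topology.IsEmbedding ι := Topology.IsEmbedding.subtypeVal
  have hcA := hc.1
  rw [← Subtype.range_coe (s := A), ← Set.image_univ] at hcA
  obtain ⟨c', -, hc'⟩ := exists_map_eq hι hcA
  have hdc : bdry q c' ∈ within (Subtype.val ⁻¹' B : Set A) q := by
    have h2 : bdry q c ∈ within (ι '' (Subtype.val ⁻¹' B)) q := by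
      have : ι '' (Subtype.val ⁻¹' B) = B := by
        change Subtype.val '' (Subtype.val ⁻¹' B) = B
        rw [Subtype.image_preimage_coe, Set.inter_eq_right.2 hBA]
      rw [this]
      exact hc.2
    obtain ⟨x, hx, hxe⟩ := exists_map_eq hι h2
    rw [← hc', bdry_map] at hxe
    rwa [← map_injective hι.injective q hxe]
  refine mem_relBoundaries.2 ⟨map h (q + 2) (prism (q + 1) c'), ?_, ?_⟩
  · exact map_mem (A := Set.univ) (fun p _ => hA p) (mem_within_univ _ _)
  · have e0 : map h (q + 1) (map (slice 0) (q + 1) c') = c := by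
      rw [map_map, ← hc']
      congr 2
      ext a
      exact h0 a
    have hcc := ZModModule.add_self c
    have e1 : c + bdry (q + 1) (map h (q + 2) (prism (q + 1) c')) =
        map (h.comp (slice 1)) (q + 1) (subdiv (q + 1) c') +
          map h (q + 1) (prism q (bdry q c')) := by
      rw [bdry_map, bdry_prism, map_add, map_add, e0, map_map]
      grind
    rw [e1]
    refine Submodule.add_mem _ ?_ ?_
    · exact map_mem (A := Set.univ) (fun a _ => h1 a) (mem_within_univ _ _)
    · exact map_mem (fun p hp => hB p.1 p.2 hp.1) (prism_mem hdc)

/-- The constant simplex at the origin. -/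
def zeroSimplex (E : Type*) [Zero E] [TopologicalSpace E] (n : ℕ) :
    C(stdSimplex ℝ (Fin n), E) := ContinuousMap.const _ 0

section Constant

variable {E : Type*} [Zero E] [TopologicalSpace E]

lemma bdry_zeroSimplex (n : ℕ) :
    bdry n (Finsupp.single (zeroSimplex E (n + 1)) (1 : ZMod 2)) =
      ((n + 1 : ℕ) : ZMod 2) • Finsupp.single (zeroSimplex E n) 1 := by
  rw [bdry_single]
  have h (i : Fin (n + 1)) : (zeroSimplex E (n + 1)).comp (face i) = zeroSimplex E n := rfl
  simp only [h, Finset.sum_const, Finset.card_univ, Fintype.card_fin, Nat.cast_smul_eq_nsmul]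

lemma eq_zero_or_eq_zeroSimplex {n : ℕ} {c : SingChain E n} (hc : c ∈ within {0} n) :
    c = 0 ∨ c = Finsupp.single (zeroSimplex E n) 1 := by
  have h : c.support ⊆ {zeroSimplex E n} := by
    intro σ hσ
    have h1 := (Finsupp.mem_supported _ _).1 hc hσ
    rw [Finset.mem_singleton]
    ext t
    exact h1 ⟨t, rfl⟩
  have h2 := Finsupp.support_subset_singleton.1 h
  have h3 : ∀ a : ZMod 2, a = 0 ∨ a = 1 := by decide
  rcases h3 (c (zeroSimplex E n)) with h4 | h4
  · left
    rw [h2, h4, Finsupp.single_zero]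
  · right
    rw [h2, h4]

end Constant

section Linear

variable {E : Type*} [AddCommGroup E] [Module ℝ E] [TopologicalSpace E] [ContinuousAdd E]
  [ContinuousSMul ℝ E]

lemma acyclic_univ_of_starConvex {A : Set E} {e : E} (hA : StarConvex ℝ e A) (he : e ∈ A) (q : ℕ) :
    Acyclic Set.univ A q := by
  let h : C(↥(Set.univ (α := E)) × unitInterval, E) :=
    ⟨fun p => (p.2 : ℝ) • e + (1 - p.2 : ℝ) • (p.1 : E), by fun_prop⟩
  refine acyclic_of_homotopy (Set.subset_univ A) h (fun a => ?_) (fun p => Set.mem_univ _)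
    (fun a => ?_) (fun a t ha => ?_) q
  · simp [h]
  · simpa [h] using he
  · exact hA ha t.2.1 (sub_nonneg.2 t.2.2) (by ring)

lemma exists_add_bdry_eq (q : ℕ) {c : SingChain E (q + 1)} (hc : c ∈ relCycles Set.univ ∅ q) :
    ∃ e, c + bdry (q + 1) e = 0 ∨
      c + bdry (q + 1) e = Finsupp.single (zeroSimplex E (q + 1)) 1 := by
  obtain ⟨e, -, he⟩ := mem_relBoundaries.1 (acyclic_univ_of_starConvex (A := {(0 : E)})
    (starConvex_singleton 0) rfl q (relCycles_mono subset_rfl (Set.empty_subset _) q hc))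
  exact ⟨e, eq_zero_or_eq_zeroSimplex he⟩

lemma oneDim_univ_empty : OneDim (Set.univ : Set E) ∅ 0 := by
  refine ⟨Finsupp.single (zeroSimplex E 1) 1, ⟨mem_within_univ _ _, mem_within_zero _ _⟩,
    fun h => ?_, fun c hc => ?_⟩
  · obtain ⟨e, -, he⟩ := mem_relBoundaries.1 h
    have h1 := congrArg (bdry 0) (eq_zero_of_mem_within_empty he)
    rw [map_add, bdry_bdry, bdry_zeroSimplex, add_zero, map_zero] at h1
    simp at h1
  · obtain ⟨e, he | he⟩ := exists_add_bdry_eq 0 hc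
    · exact Or.inl (mem_relBoundaries.2 ⟨e, mem_within_univ _ _, by rw [he]; exact zero_mem _⟩)
    · refine Or.inr (mem_relBoundaries.2 ⟨e, mem_within_univ _ _, ?_⟩)
      rw [add_right_comm, he, ZModModule.add_self]
      exact zero_mem _

lemma acyclic_univ_empty (q : ℕ) : Acyclic (Set.univ : Set E) ∅ (q + 1) := by
  intro c hc
  obtain ⟨e, he | he⟩ := exists_add_bdry_eq (q + 1) hc
  · exact mem_relBoundaries.2 ⟨e, mem_within_univ _ _, by rw [he]; exact zero_mem _⟩
  -- As it is a cycle here, the constant simplex has an even number of faces. The constant simplex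
  -- one dimension higher then has an odd number of faces, all equal to it, so it is a boundary.
  have h1 := congrArg (bdry (q + 1)) he
  rw [map_add, bdry_bdry, add_zero, bdry_zeroSimplex, eq_zero_of_mem_within_empty hc.2] at h1
  have h2 : ((q + 1 + 1 : ℕ) : ZMod 2) = 0 := by
    by_contra h3
    have h4 := (smul_eq_zero.1 h1.symm).resolve_left h3
    simp at h4
  refine mem_relBoundaries.2
    ⟨e + Finsupp.single (zeroSimplex E (q + 3)) 1, mem_within_univ _ _, ?_⟩
  have h3 : ((q + 2 + 1 : ℕ) : ZMod 2) = 1 := by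
    have h4 : ((q + 2 + 1 : ℕ) : ZMod 2) = ((q + 1 + 1 : ℕ) : ZMod 2) + 1 := by push_cast; ring
    rw [h4, h2, zero_add]
  rw [map_add, ← add_assoc, he, bdry_zeroSimplex, h3, one_smul, ZModModule.add_self]
  exact zero_mem _

end Linear

section Coordinates

variable {ι : Type*}

/-- The coordinate subspace on which the coordinates in `s` vanish. -/
def coordSubspace (s : Finset ι) : Set (ι → ℝ) := {p | ∀ i ∈ s, p i = 0}

/-- The complement of the closed half of `coordSubspace s` on which `ε * p i ≤ 0`, where `ε` is a
sign. -/
def halfCompl (s : Finset ι) (i : ι) (ε : ℝ) : Set (ι → ℝ) :=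
  {p | p ∈ coordSubspace s → 0 < ε * p i}

lemma isClosed_coordSubspace (s : Finset ι) : IsClosed (coordSubspace s) := by
  have : coordSubspace s = ⋂ i ∈ s, {p : ι → ℝ | p i = 0} := by
    ext
    simp [coordSubspace]
  rw [this]
  exact isClosed_biInter fun i _ => isClosed_eq (continuous_apply i) continuous_const

lemma isOpen_halfCompl (s : Finset ι) (i : ι) (ε : ℝ) : IsOpen (halfCompl s i ε) := by
  have : halfCompl s i ε = (coordSubspace s)ᶜ ∪ {p | 0 < ε * p i} := by
    ext
    simp [halfCompl, imp_iff_not_or]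
  rw [this]
  exact (isClosed_coordSubspace s).isOpen_compl.union
    (isOpen_lt continuous_const (by fun_prop))

lemma halfCompl_inter (s : Finset ι) (i : ι) :
    halfCompl s i 1 ∩ halfCompl s i (-1) = (coordSubspace s)ᶜ := by
  ext p
  simp only [halfCompl, Set.mem_inter_iff, Set.mem_ofPred_eq, Set.mem_compl_iff]
  constructor
  · rintro ⟨h1, h2⟩ h
    linarith [h1 h, h2 h]
  · exact fun h => ⟨fun h' => absurd h' h, fun h' => absurd h' h⟩

variable [DecidableEq ι]

lemma halfCompl_union (s : Finset ι) (i : ι) :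
    halfCompl s i 1 ∪ halfCompl s i (-1) = (coordSubspace (insert i s))ᶜ := by
  ext p
  have : p ∈ coordSubspace (insert i s) ↔ p i = 0 ∧ p ∈ coordSubspace s := by
    simp [coordSubspace]
  simp only [halfCompl, Set.mem_union, Set.mem_ofPred_eq, Set.mem_compl_iff, this]
  constructor
  · rintro (h | h) ⟨h0, hs⟩ <;> simpa [h0] using h hs
  · intro h
    by_cases hs : p ∈ coordSubspace s
    · rcases lt_or_gt_of_ne (fun h0 => h ⟨h0, hs⟩) with h1 | h1
      · right
        intro
        linarith
      · left
        intro
        linarith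
    · exact Or.inl fun h' => absurd h' hs

lemma acyclic_halfCompl {s : Finset ι} {i : ι} (hi : i ∉ s) {ε : ℝ} (hε : ε * ε = 1) (q : ℕ) :
    Acyclic Set.univ (halfCompl s i ε) q := by
  have hL : ∀ j ∈ s, (Pi.single i ε : ι → ℝ) j = 0 := fun j hj =>
    Pi.single_eq_of_ne (fun h => hi (by rwa [← h])) _
  refine acyclic_univ_of_starConvex (e := Pi.single i ε) (fun p hp a b ha hb hab h => ?_) ?_ q
  · rcases hb.eq_or_lt with rfl | hb
    · obtain rfl : a = 1 := by linarith
      simp [hε]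
    · have hps : p ∈ coordSubspace s := by
        intro j hj
        have h1 := h j hj
        simp only [Pi.add_apply, Pi.smul_apply, smul_eq_mul, hL j hj, mul_zero, zero_add] at h1
        exact (mul_eq_zero.1 h1).resolve_left hb.ne'
      have h2 := hp hps
      simp only [Pi.add_apply, Pi.smul_apply, smul_eq_mul, Pi.single_eq_same]
      have h3 : ε * (a * ε + b * p i) = a * (ε * ε) + b * (ε * p i) := by ring
      rw [h3, hε]
      nlinarith
  · intro _
    simp [hε]

/-- The local homology of Euclidean space along a coordinate subspace is one-dimensional,
concentrated in the degree given by the codimension. Adding an equation splits the previous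
subspace into two half-spaces, whose complements are star-shaped, and Mayer–Vietoris shifts the
degree by one. -/
theorem oneDim_and_acyclic_coordSubspace (s : Finset ι) :
    OneDim Set.univ (coordSubspace s)ᶜ s.card ∧
      ∀ q, q ≠ s.card → Acyclic Set.univ (coordSubspace s)ᶜ q := by
  induction s using Finset.induction_on with
  | empty =>
    have : (coordSubspace (∅ : Finset ι))ᶜ = ∅ := by simp [coordSubspace]
    rw [this, Finset.card_empty]
    refine ⟨oneDim_univ_empty, fun q hq => ?_⟩
    obtain ⟨p, rfl⟩ := Nat.exists_eq_succ_of_ne_zero hq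
    exact acyclic_univ_empty p
  | insert i s hi ih =>
    have hA := acyclic_halfCompl hi (ε := 1) (by norm_num)
    have hB := acyclic_halfCompl hi (ε := -1) (by norm_num)
    have hsame := sameHomology_inter_union (isOpen_halfCompl s i 1) (isOpen_halfCompl s i (-1))
      (Set.subset_univ _) (Set.subset_univ _) hA hB
    simp only [halfCompl_inter, halfCompl_union] at hsame
    rw [Finset.card_insert_of_notMem hi]
    refine ⟨(hsame _).hasTwoClasses ih.1, fun q hq => ?_⟩
    cases q with
    | zero =>
      rw [← halfCompl_union]
      exact acyclic_zero_of_subset Set.subset_union_left (hA 0)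
    | succ q => exact (hsame q).le (ih.2 q (by omega))

end Coordinates

end SingChain

/-! ### Vanishing of the connecting homomorphism and assembly of a filtration -/

namespace SingChain

variable {X : Type*} [TopologicalSpace X]

/-- The reflection argument. Let `A` and `B` be open subsets of `O` which are exchanged by the
involution `R`. Up to a boundary, the boundary of a relative cycle of `(O, A ∪ B)` is a sum
`α + β` with `α` in `A` and `β` in `B`. As the homology of `(O, A ∩ B)` is one-dimensional, `β` is
homologous to `R α`, and as the homology of `(W, W')` is one-dimensional, `R α` is homologous to `α`
there. So the boundary is homologous to `α + α = 0`. -/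
lemma bdry_mem_relBoundaries_of_involution {R : C(X, X)} (hR : ∀ x, R (R x) = x)
    {O A B W W' : Set X} {n : ℕ} (hA : IsOpen A) (hB : IsOpen B) (hAO : A ⊆ O) (hBO : B ⊆ O)
    (hRO : Set.MapsTo R O O) (hRA : Set.MapsTo R A B) (hRB : Set.MapsTo R B A)
    (hRW : Set.MapsTo R W W) (hRW' : Set.MapsTo R W' W') (hW : A ∪ B ⊆ W) (hW' : A ∩ B ⊆ W')
    (hOne : OneDim O (A ∩ B) n) (hAc : Acyclic O B (n + 1)) (hOneW : OneDim W W' n)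
    {c : SingChain X (n + 1 + 1)} (hc : c ∈ relCycles O (A ∪ B) (n + 1)) :
    bdry (n + 1) c ∈ relBoundaries W W' n := by
  have hRR (z : SingChain X (n + 1)) : map R (n + 1) (map R (n + 1) z) = z := by
    rw [map_map]
    have : R.comp R = ContinuousMap.id X := by
      ext x
      exact hR x
    rw [this, map_id]
  have hRAB : Set.MapsTo R (A ∩ B) (A ∩ B) := fun x hx => ⟨hRB hx.2, hRA hx.1⟩
  obtain ⟨y, hy, hcy⟩ := exists_add_bdry_mem_sup hA hB hc.2 (by
    rw [bdry_bdry]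
    exact Submodule.zero_mem _)
  obtain ⟨α, hα, β, hβ, hαβ⟩ := Submodule.mem_sup.1 hcy
  have hdα : bdry n α ∈ within (A ∩ B) n := by
    rw [within_inter]
    refine ⟨bdry_mem hα, ?_⟩
    have h1 : bdry n α + bdry n β = 0 := by
      rw [← map_add, hαβ, map_add, bdry_bdry, bdry_bdry, add_zero]
    have h2 : bdry n α = bdry n β := by
      have := ZModModule.add_self (bdry n β)
      grind
    rw [h2]
    exact bdry_mem hβ
  have hαZ : α ∈ relCycles A (A ∩ B) n := ⟨hα, hdα⟩
  have h1 : α + map R (n + 1) α ∈ relBoundaries O (A ∩ B) n :=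
    hOne.add_apply_mem (map R (n + 1)) (fun z hz => map_mem_relCycles hRO hRAB hz)
      (fun z hz => map_mem_relBoundaries hRO hRAB hz) hRR (relCycles_mono hAO subset_rfl n hαZ)
  have h2 : α + map R (n + 1) α ∈ relBoundaries W W' n :=
    hOneW.add_apply_mem (map R (n + 1)) (fun z hz => map_mem_relCycles hRW hRW' hz)
      (fun z hz => map_mem_relBoundaries hRW hRW' hz) hRR
      (relCycles_mono (Set.subset_union_left.trans hW) hW' n hαZ)
  have hαα := ZModModule.add_self α
  have h3 : β + map R (n + 1) α ∈ relBoundaries O (A ∩ B) n := by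
    have h4 : α + β ∈ relBoundaries O (A ∩ B) n := by
      refine Submodule.mem_sup_right ⟨c + y, Submodule.add_mem _ hc.1
        (within_mono (Set.union_subset hAO hBO) _ hy), ?_⟩
      rw [hαβ, map_add]
    have h5 : β + map R (n + 1) α = (α + β) + (α + map R (n + 1) α) := by grind
    rw [h5]
    exact Submodule.add_mem _ h4 h1
  have h4 : β + map R (n + 1) α ∈ relBoundaries W W' n := by
    obtain ⟨e, he, h5⟩ := mem_relBoundaries.1 h3
    have hβR : β + map R (n + 1) α ∈ within B (n + 1) := Submodule.add_mem _ hβ (map_mem hRA hα)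
    have heB : e ∈ relCycles O B (n + 1) := by
      refine ⟨he, ?_⟩
      have h6 : bdry (n + 1) e =
          (β + map R (n + 1) α) + (β + map R (n + 1) α + bdry (n + 1) e) := by
        rw [← add_assoc, ZModModule.add_self, zero_add]
      rw [SetLike.mem_coe, Submodule.mem_comap, h6]
      exact Submodule.add_mem _ hβR (within_mono Set.inter_subset_right _ h5)
    obtain ⟨f, hf, h7⟩ := mem_relBoundaries.1 (hAc heB)
    refine relBoundaries_mono (Set.subset_union_right.trans hW) hW' n
      (mem_relBoundaries.2 ⟨_, h7, ?_⟩)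
    rw [map_add, bdry_bdry, add_zero]
    exact h5
  have h5 : bdry (n + 1) y ∈ relBoundaries W W' n :=
    Submodule.mem_sup_right ⟨y, within_mono hW _ hy, rfl⟩
  have h6 : bdry (n + 1) c = (β + map R (n + 1) α) + (α + map R (n + 1) α) + bdry (n + 1) y := by
    have h7 := ZModModule.add_self (map R (n + 1) α)
    have h8 := ZModModule.add_self (bdry (n + 1) y)
    grind
  rw [h6]
  exact Submodule.add_mem _ (Submodule.add_mem _ h4 h2) h5

/-- A decreasing filtration whose `k`-th step has one-dimensional homology, concentrated in degree
`d - k`, and whose connecting homomorphisms between successive steps vanish. -/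
theorem oneDim_and_acyclic_of_filtration {W : ℕ → Set X} {d m : ℕ} (hmd : m ≤ d)
    (hW0 : W 0 = Set.univ) (hWanti : ∀ k, W (k + 1) ⊆ W k)
    (hOne : ∀ k ≤ m, OneDim (W k) (W (k + 1)) (d - k))
    (hAc : ∀ k ≤ m, ∀ q, q ≠ d - k → Acyclic (W k) (W (k + 1)) q)
    (hconn : ∀ k < m, ∀ n, n + 1 = d - k → ∀ c ∈ relCycles (W k) (W (k + 1)) (n + 1),
      bdry (n + 1) c ∈ relBoundaries (W (k + 1)) (W (k + 2)) n) (j : ℕ) (hj : j ≤ m + 1) :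
    (∀ q, d < q + j → q ≤ d → OneDim Set.univ (W j) q) ∧
      ∀ q, ¬ (d < q + j ∧ q ≤ d) → Acyclic Set.univ (W j) q := by
  induction j using Nat.strong_induction_on with
  | _ j ih =>
  cases j with
  | zero =>
    refine ⟨fun q h1 h2 => by omega, fun q _ => ?_⟩
    rw [hW0]
    exact acyclic_self _ _
  | succ j =>
    obtain ⟨ih1, ih2⟩ := ih j (by omega) (by omega)
    have hjm : j ≤ m := by omega
    have key : ∀ p, ∀ c ∈ relCycles Set.univ (W j) (p + 1),
        bdry (p + 1) c ∈ relBoundaries (W j) (W (j + 1)) p := by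
      intro p c hc
      by_cases hp : p = d - j
      · cases j with
        | zero =>
          rw [hW0]
          exact Submodule.mem_sup_right ⟨c, mem_within_univ _ _, rfl⟩
        | succ k =>
          -- The class comes from the previous step of the filtration, since the homology of
          -- `(X, W k)` vanishes in this degree.
          have h0 := (ih k (by omega) (by omega)).2 (p + 1) (by omega)
          obtain ⟨e, -, h1⟩ := mem_relBoundaries.1
            (h0 (relCycles_mono subset_rfl (hWanti k) (p + 1) hc))
          have h2 : bdry (p + 1) (c + bdry (p + 1 + 1) e) = bdry (p + 1) c := by
            rw [map_add, bdry_bdry, add_zero]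
          rw [← h2]
          refine hconn k (by omega) p (by omega) _ ⟨h1, ?_⟩
          rw [SetLike.mem_coe, Submodule.mem_comap, h2]
          exact hc.2
      · refine hAc j hjm p hp ⟨hc.2, ?_⟩
        rw [SetLike.mem_coe, Submodule.mem_comap, bdry_bdry]
        exact zero_mem _
    refine ⟨fun q h1 h2 => ?_, fun q h => ?_⟩
    · by_cases hq : q = d - j
      · subst hq
        exact (sameHomology_of_acyclic' (hWanti j) (Set.subset_univ _) (ih2 _ (by omega))
          (key _)).hasTwoClasses (hOne j hjm)
      · exact (sameHomology_of_acyclic (hWanti j) (Set.subset_univ _) (hAc j hjm q hq)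
          (fun p hp => key p)).symm.hasTwoClasses (ih1 q (by omega) h2)
    · by_cases hq : q = d - j
      · omega
      · exact (sameHomology_of_acyclic (hWanti j) (Set.subset_univ _) (hAc j hjm q hq)
          (fun p hp => key p)).symm.le (ih2 q (by omega))

end SingChain

/-! ### The symmetric square of the sphere -/

section SymmetricSquare

variable {X : Type*} [TopologicalSpace X]

/-- The quotient map onto the symmetric square is open, being the quotient by a finite group. -/
lemma Sym2.isOpenMap_mk : IsOpenMap (fun p : X × X => s(p.1, p.2)) := by
  intro U hU
  have hq : Topology.IsQuotientMap (Quot.mk (Sym2.Rel X)) := isQuotientMap_quot_mk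
  rw [← hq.isOpen_preimage]
  have : Quot.mk (Sym2.Rel X) ⁻¹' ((fun p : X × X => s(p.1, p.2)) '' U) =
      U ∪ Prod.swap ⁻¹' U := by
    ext ⟨x, y⟩
    simp only [Set.mem_preimage, Set.mem_image, Set.mem_union, Prod.exists]
    constructor
    · rintro ⟨a, b, hab, h⟩
      rcases Sym2.eq_iff.1 h with ⟨rfl, rfl⟩ | ⟨rfl, rfl⟩
      · exact Or.inl hab
      · exact Or.inr hab
    · rintro (h | h)
      · exact ⟨x, y, h, rfl⟩
      · exact ⟨y, x, h, Sym2.eq_swap⟩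
  rw [this]
  exact hU.union (hU.preimage continuous_swap)

lemma Sym2.continuous_mk : Continuous (fun p : X × X => s(p.1, p.2)) := continuous_quot_mk

lemma Sym2.isOpenQuotientMap_mk : IsOpenQuotientMap (fun p : X × X => s(p.1, p.2)) :=
  ⟨fun z => z.inductionOn fun x y => ⟨(x, y), rfl⟩, Sym2.continuous_mk, Sym2.isOpenMap_mk⟩

end SymmetricSquare

namespace SphereSquare

variable {m : ℕ}

/-- The Euclidean space containing the sphere. -/
abbrev Ambient (m : ℕ) : Type := EuclideanSpace ℝ (Fin (m + 1))

/-- The radial projection of a nonzero vector to the sphere. -/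
noncomputable def normalize (v : Ambient m) (hv : v ≠ 0) : unitSphere m :=
  ⟨‖v‖⁻¹ • v, by
    rw [mem_sphere_zero_iff_norm, norm_smul, norm_inv, norm_norm,
      inv_mul_cancel₀ (norm_ne_zero_iff.2 hv)]⟩

lemma coe_normalize (v : Ambient m) (hv : v ≠ 0) : (normalize v hv : Ambient m) = ‖v‖⁻¹ • v := rfl

lemma continuous_normalize {Y : Type*} [TopologicalSpace Y] {f : Y → Ambient m} (hf : Continuous f)
    (h0 : ∀ y, f y ≠ 0) : Continuous fun y => normalize (f y) (h0 y) :=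
  Continuous.subtype_mk ((hf.norm.inv₀ fun y => norm_ne_zero_iff.2 (h0 y)).smul hf) _

/-- The unordered pairs of antipodal points on the subsphere where all coordinates with index at
least `j` vanish. This is a projective space of dimension `j - 1`. -/
def antipodal (m j : ℕ) : Set (Sym2 (unitSphere m)) :=
  {z | ∃ x : unitSphere m, z = s(x, -x) ∧ ∀ i : Fin (m + 1), j ≤ i → (x : Ambient m) i = 0}

lemma mk_mem_antipodal {j : ℕ} {x y : unitSphere m} :
    s(x, y) ∈ antipodal m j ↔
      y = -x ∧ ∀ i : Fin (m + 1), j ≤ i → (x : Ambient m) i = 0 := by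
  constructor
  · rintro ⟨w, h, hw⟩
    rcases Sym2.eq_iff.1 h with ⟨rfl, rfl⟩ | ⟨rfl, rfl⟩
    · exact ⟨rfl, hw⟩
    · exact ⟨(neg_neg _).symm, fun i hi => by simpa using hw i hi⟩
  · rintro ⟨rfl, h⟩
    exact ⟨x, rfl, h⟩

lemma isClosed_antipodal (m j : ℕ) : IsClosed (antipodal m j) := by
  rw [← (Sym2.isOpenQuotientMap_mk (X := unitSphere m)).isQuotientMap.isClosed_preimage]
  have : (fun p : unitSphere m × unitSphere m => s(p.1, p.2)) ⁻¹' antipodal m j =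
      {p | p.2 = -p.1} ∩ ⋂ i : Fin (m + 1), ⋂ _ : j ≤ i, {p | (p.1 : Ambient m) i = 0} := by
    ext p
    simp [mk_mem_antipodal]
  rw [this]
  refine (isClosed_eq (by fun_prop) (by fun_prop)).inter
    (isClosed_iInter fun i => isClosed_iInter fun _ => isClosed_eq (by fun_prop) (by fun_prop))

lemma antipodal_mono {i j : ℕ} (h : i ≤ j) : antipodal m i ⊆ antipodal m j := by
  rintro z ⟨x, hz, hx⟩
  exact ⟨x, hz, fun l hl => hx l (h.trans hl)⟩

lemma antipodal_zero : antipodal m 0 = ∅ := by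
  rw [Set.eq_empty_iff_forall_notMem]
  rintro z ⟨x, -, hx⟩
  have h0 : (x : Ambient m) = 0 := by
    ext i
    exact hx i (Nat.zero_le _)
  exact ne_zero_of_mem_unit_sphere x h0

/-- The unordered pairs of points with distinct `k`-th coordinates. -/
def separated (k : Fin (m + 1)) : Set (Sym2 (unitSphere m)) :=
  {z | ∃ x y : unitSphere m, z = s(x, y) ∧ (y : Ambient m) k < (x : Ambient m) k}

/-- The sets to which excision is applied: the pairs separated by the `k`-th coordinate contain all
of `antipodal m (k + 1)` outside `antipodal m k`. -/
lemma separated_union (k : Fin (m + 1)) :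
    separated k ∪ (antipodal m (k + 1))ᶜ = (antipodal m k)ᶜ := by
  ext z
  simp only [Set.mem_union, Set.mem_compl_iff]
  constructor
  · rintro (⟨x, y, rfl, h⟩ | h) h'
    · obtain ⟨rfl, h2⟩ := mk_mem_antipodal.1 h'
      have := h2 k le_rfl
      simp [this] at h
    · exact h (antipodal_mono (Nat.le_succ _) h')
  · intro h
    by_contra! h'
    obtain ⟨h1, x, rfl, hx⟩ := h'
    refine h ⟨x, rfl, fun i hi => ?_⟩
    rcases hi.eq_or_lt with hi | hi
    · obtain rfl : k = i := Fin.ext hi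
      by_contra h0
      rcases lt_or_gt_of_ne h0 with h0 | h0
      · exact h1 ⟨-x, x, Sym2.eq_swap, by simp; linarith⟩
      · exact h1 ⟨x, -x, rfl, by simp; linarith⟩
    · exact hx i hi

/-! ### Charts of the configuration space of unordered pairs -/

/-- The index type of the coordinates of the chart `chart k`: the left summand describes the
midpoint and the right summand the direction of a pair. -/
abbrev ChartIndex (k : Fin (m + 1)) : Type :=
  {i : Fin (m + 1) // i ≠ k} ⊕ {i : Fin (m + 1) // i ≠ k}

/-- The direction `x - y`, scaled to have `k`-th coordinate `1`. -/
noncomputable def direction (k : Fin (m + 1)) (p : ChartIndex k → ℝ) : Ambient m :=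
  WithLp.toLp 2 fun i => if h : i = k then 1 else p (Sum.inr ⟨i, h⟩)

/-- The sum `x + y` in the scaling in which `x - y` has `k`-th coordinate `1`. Its `k`-th coordinate
makes it orthogonal to the direction. -/
noncomputable def midpoint (k : Fin (m + 1)) (p : ChartIndex k → ℝ) : Ambient m :=
  WithLp.toLp 2 fun i =>
    if h : i = k then -∑ j, p (Sum.inr j) * p (Sum.inl j) else p (Sum.inl ⟨i, h⟩)

variable (k : Fin (m + 1)) (p : ChartIndex k → ℝ)

@[simp] lemma direction_self : direction k p k = 1 := by simp [direction]

@[simp] lemma direction_coe (i : {i : Fin (m + 1) // i ≠ k}) :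
    direction k p i = p (Sum.inr i) := by simp [direction, i.2]

@[simp] lemma midpoint_self : midpoint k p k = -∑ j, p (Sum.inr j) * p (Sum.inl j) := by
  simp [midpoint]

@[simp] lemma midpoint_coe (i : {i : Fin (m + 1) // i ≠ k}) :
    midpoint k p i = p (Sum.inl i) := by simp [midpoint, i.2]

@[fun_prop] lemma continuous_direction : Continuous (direction (m := m) k) := by
  refine (PiLp.continuous_toLp 2 _).comp (continuous_pi fun i => ?_)
  by_cases h : i = k
  · simp only [h, dite_true]
    exact continuous_const
  · simp only [h, dite_false]
    fun_prop

@[fun_prop] lemma continuous_midpoint : Continuous (midpoint (m := m) k) := by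
  refine (PiLp.continuous_toLp 2 _).comp (continuous_pi fun i => ?_)
  by_cases h : i = k
  · simp only [h, dite_true]
    fun_prop
  · simp only [h, dite_false]
    fun_prop

lemma inner_midpoint_direction : inner ℝ (midpoint k p) (direction k p) = 0 := by
  rw [PiLp.inner_apply, Fintype.sum_eq_add_sum_subtype_ne _ k]
  simp [mul_comm]

lemma norm_midpoint_sub_direction :
    ‖midpoint k p - direction k p‖ = ‖midpoint k p + direction k p‖ :=
  norm_sub_eq_norm_add (by rw [real_inner_comm, inner_midpoint_direction])

lemma midpoint_add_direction_ne_zero : midpoint k p + direction k p ≠ 0 := by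
  intro h
  have h1 := inner_midpoint_direction k p
  rw [eq_neg_of_add_eq_zero_left h, inner_neg_left, neg_eq_zero, inner_self_eq_zero] at h1
  have := direction_self k p
  simp [h1] at this

lemma midpoint_sub_direction_ne_zero : midpoint k p - direction k p ≠ 0 := by
  rw [← norm_ne_zero_iff, norm_midpoint_sub_direction, norm_ne_zero_iff]
  exact midpoint_add_direction_ne_zero k p

/-- The first point of the pair with given chart coordinates. -/
noncomputable def upperPoint : unitSphere m :=
  normalize (midpoint k p + direction k p) (midpoint_add_direction_ne_zero k p)

/-- The second point of the pair with given chart coordinates. -/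
noncomputable def lowerPoint : unitSphere m :=
  normalize (midpoint k p - direction k p) (midpoint_sub_direction_ne_zero k p)

/-- The chart coordinates of an ordered pair of points. -/
noncomputable def chartCoord (x y : Ambient m) : ChartIndex k → ℝ :=
  Sum.elim (fun j => (x j + y j) / (x k - y k)) (fun j => (x j - y j) / (x k - y k))

lemma direction_chartCoord {x y : Ambient m} (h : y k < x k) :
    direction k (chartCoord k x y) = (x k - y k)⁻¹ • (x - y) := by
  have h0 : x k - y k ≠ 0 := by linarith
  ext i
  by_cases hi : i = k
  · subst hi
    simp [h0]
  · rw [show i = ((⟨i, hi⟩ : {i : Fin (m + 1) // i ≠ k}) : Fin (m + 1)) from rfl, direction_coe]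
    simp [chartCoord, div_eq_inv_mul]

/-- The sum and the difference of two unit vectors are orthogonal, which determines the `k`-th
coordinate of the sum from the chart coordinates. -/
lemma midpoint_chartCoord {x y : unitSphere m} (h : (y : Ambient m) k < (x : Ambient m) k) :
    midpoint k (chartCoord k x y) =
      ((x : Ambient m) k - (y : Ambient m) k)⁻¹ • ((x : Ambient m) + y) := by
  have h0 : (x : Ambient m) k - (y : Ambient m) k ≠ 0 := by linarith
  have horth : inner ℝ ((x : Ambient m) + y) ((x : Ambient m) - y) = 0 := by
    rw [inner_add_left, inner_sub_right, inner_sub_right, real_inner_self_eq_norm_sq,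
      real_inner_self_eq_norm_sq, real_inner_comm, norm_eq_of_mem_sphere, norm_eq_of_mem_sphere]
    ring
  rw [PiLp.inner_apply, Fintype.sum_eq_add_sum_subtype_ne _ k] at horth
  ext i
  by_cases hi : i = k
  · subst hi
    rw [midpoint_self]
    simp only [chartCoord, Sum.elim_inl, Sum.elim_inr, PiLp.smul_apply, PiLp.add_apply, smul_eq_mul]
    simp only [RCLike.inner_apply, conj_trivial, PiLp.add_apply, PiLp.sub_apply] at horth
    have h1 : ∑ j : {j // j ≠ i}, ((x : Ambient m) j - (y : Ambient m) j) /
        ((x : Ambient m) i - (y : Ambient m) i) * (((x : Ambient m) j + (y : Ambient m) j) /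
        ((x : Ambient m) i - (y : Ambient m) i)) = (∑ j : {j // j ≠ i},
        ((x : Ambient m) j - (y : Ambient m) j) * ((x : Ambient m) j + (y : Ambient m) j)) /
        ((x : Ambient m) i - (y : Ambient m) i) ^ 2 := by
      rw [Finset.sum_div]
      refine Finset.sum_congr rfl fun j _ => ?_
      field_simp
    rw [h1]
    field_simp
    linarith
  · rw [show i = ((⟨i, hi⟩ : {i : Fin (m + 1) // i ≠ k}) : Fin (m + 1)) from rfl, midpoint_coe]
    simp [chartCoord, div_eq_inv_mul, mul_add]

lemma upperPoint_sub_lowerPoint : (upperPoint k p : Ambient m) - lowerPoint k p =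
    (2 * ‖midpoint k p + direction k p‖⁻¹) • direction k p := by
  rw [upperPoint, lowerPoint, coe_normalize, coe_normalize, norm_midpoint_sub_direction]
  module

lemma upperPoint_add_lowerPoint : (upperPoint k p : Ambient m) + lowerPoint k p =
    (2 * ‖midpoint k p + direction k p‖⁻¹) • midpoint k p := by
  rw [upperPoint, lowerPoint, coe_normalize, coe_normalize, norm_midpoint_sub_direction]
  module

lemma scale_pos : 0 < 2 * ‖midpoint k p + direction k p‖⁻¹ := by
  have := norm_pos_iff.2 (midpoint_add_direction_ne_zero k p)
  positivity

lemma lowerPoint_lt_upperPoint :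
    (lowerPoint k p : Ambient m) k < (upperPoint k p : Ambient m) k := by
  have h := congrArg (fun v : Ambient m => v k) (upperPoint_sub_lowerPoint k p)
  simp only [PiLp.sub_apply, PiLp.smul_apply, direction_self, smul_eq_mul, mul_one] at h
  linarith [scale_pos k p]

lemma chartCoord_points : chartCoord k (upperPoint k p) (lowerPoint k p) = p := by
  have hs (i : Fin (m + 1)) := congrArg (fun v : Ambient m => v i) (upperPoint_sub_lowerPoint k p)
  have ha (i : Fin (m + 1)) := congrArg (fun v : Ambient m => v i) (upperPoint_add_lowerPoint k p)
  simp only [PiLp.sub_apply, PiLp.add_apply, PiLp.smul_apply, smul_eq_mul] at hs ha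
  have h0 := (scale_pos k p).ne'
  funext i
  rcases i with i | i
  · simp only [chartCoord, Sum.elim_inl]
    rw [hs, ha, direction_self, midpoint_coe, mul_one, mul_div_cancel_left₀ _ h0]
  · simp only [chartCoord, Sum.elim_inr]
    rw [hs, hs, direction_self, direction_coe, mul_one, mul_div_cancel_left₀ _ h0]

lemma normalize_eq {v : Ambient m} (hv : v ≠ 0) {x : unitSphere m} {a : ℝ} (ha : 0 < a)
    (h : v = a • (x : Ambient m)) : normalize v hv = x := by
  apply Subtype.ext
  rw [coe_normalize, h, norm_smul, norm_eq_of_mem_sphere, Real.norm_of_nonneg ha.le, mul_one,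
    smul_smul, inv_mul_cancel₀ ha.ne', one_smul]

lemma upperPoint_chartCoord {x y : unitSphere m} (h : (y : Ambient m) k < (x : Ambient m) k) :
    upperPoint k (chartCoord k x y) = x := by
  refine normalize_eq _ (a := 2 * ((x : Ambient m) k - (y : Ambient m) k)⁻¹)
    (mul_pos two_pos (inv_pos.2 (sub_pos.2 h))) ?_
  rw [direction_chartCoord k h, midpoint_chartCoord k h]
  module

lemma lowerPoint_chartCoord {x y : unitSphere m} (h : (y : Ambient m) k < (x : Ambient m) k) :
    lowerPoint k (chartCoord k x y) = y := by
  refine normalize_eq _ (a := 2 * ((x : Ambient m) k - (y : Ambient m) k)⁻¹)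
    (mul_pos two_pos (inv_pos.2 (sub_pos.2 h))) ?_
  rw [direction_chartCoord k h, midpoint_chartCoord k h]
  module

/-- The chart as a homeomorphism onto the ordered pairs with decreasing `k`-th coordinate. -/
noncomputable def chartHomeomorph : (ChartIndex k → ℝ) ≃ₜ
    {z : unitSphere m × unitSphere m // (z.2 : Ambient m) k < (z.1 : Ambient m) k} where
  toFun p := ⟨(upperPoint k p, lowerPoint k p), lowerPoint_lt_upperPoint k p⟩
  invFun z := chartCoord k z.1.1 z.1.2
  left_inv p := chartCoord_points k p
  right_inv z := Subtype.ext (Prod.ext (upperPoint_chartCoord k z.2) (lowerPoint_chartCoord k z.2))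
  continuous_toFun := by
    refine Continuous.subtype_mk (Continuous.prodMk ?_ ?_) _
    · exact continuous_normalize (by fun_prop) _
    · exact continuous_normalize (by fun_prop) _
  continuous_invFun := by
    refine continuous_pi fun i => ?_
    rcases i with i | i
    · exact Continuous.div (by fun_prop) (by fun_prop) fun z => (sub_pos.2 z.2).ne'
    · exact Continuous.div (by fun_prop) (by fun_prop) fun z => (sub_pos.2 z.2).ne'

/-- The chart on the unordered pairs with distinct `k`-th coordinates. -/
noncomputable def chart : C(ChartIndex k → ℝ, Sym2 (unitSphere m)) where
  toFun p := s(upperPoint k p, lowerPoint k p)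
  continuous_toFun := Sym2.continuous_mk.comp
    (continuous_subtype_val.comp (chartHomeomorph k).continuous)

lemma chart_apply : chart k p = s(upperPoint k p, lowerPoint k p) := rfl

lemma isOpenEmbedding_chart : Topology.IsOpenEmbedding (chart (m := m) k) := by
  refine .of_continuous_injective_isOpenMap (chart k).continuous (fun p p' h => ?_) ?_
  · rcases Sym2.eq_iff.1 h with ⟨h1, h2⟩ | ⟨h1, h2⟩
    · rw [← chartCoord_points k p, h1, h2, chartCoord_points]
    · have h3 := lowerPoint_lt_upperPoint k p
      rw [h1, h2] at h3
      exact absurd h3 (lowerPoint_lt_upperPoint k p').not_gt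
  · have ho : IsOpen {z : unitSphere m × unitSphere m |
        (z.2 : Ambient m) k < (z.1 : Ambient m) k} :=
      isOpen_lt (by fun_prop) (by fun_prop)
    exact Sym2.isOpenMap_mk.comp (ho.isOpenMap_subtype_val.comp (chartHomeomorph k).isOpenMap)

lemma range_chart : Set.range (chart (m := m) k) = separated k := by
  ext z
  constructor
  · rintro ⟨p, rfl⟩
    exact ⟨_, _, rfl, lowerPoint_lt_upperPoint k p⟩
  · rintro ⟨x, y, rfl, h⟩
    refine ⟨chartCoord k x y, ?_⟩
    rw [chart_apply, upperPoint_chartCoord k h, lowerPoint_chartCoord k h]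

lemma isOpen_separated : IsOpen (separated (m := m) k) := by
  rw [← range_chart]
  exact (isOpenEmbedding_chart k).isOpen_range

end SphereSquare

/-! ### Local homology along the antipodal pairs -/

namespace SphereSquare

open SingChain

variable {m : ℕ}

/-- The chart coordinates which vanish on `antipodal m j`: the midpoint, and the coordinates of the
direction with index at least `j`. -/
def normalCoords (k : Fin (m + 1)) (j : ℕ) : Finset (ChartIndex k) :=
  Finset.univ.disjSum (Finset.univ.filter fun i => j ≤ (i : Fin (m + 1)))

lemma mem_coordSubspace_normalCoords {k : Fin (m + 1)} {j : ℕ} {p : ChartIndex k → ℝ} :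
    p ∈ coordSubspace (normalCoords k j) ↔
      (∀ i, p (Sum.inl i) = 0) ∧
        ∀ i : {i : Fin (m + 1) // i ≠ k}, j ≤ (i : Fin (m + 1)) → p (Sum.inr i) = 0 := by
  simp [coordSubspace, normalCoords]

lemma chart_mem_antipodal_iff {k : Fin (m + 1)} {j : ℕ} (hkj : k < j) {p : ChartIndex k → ℝ} :
    chart k p ∈ antipodal m j ↔ p ∈ coordSubspace (normalCoords k j) := by
  have h0 := (scale_pos k p).ne'
  have hmid : lowerPoint k p = -upperPoint k p ↔ midpoint k p = 0 := by
    have h1 := upperPoint_add_lowerPoint k p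
    constructor
    · intro h
      rw [h] at h1
      have h2 : (2 * ‖midpoint k p + direction k p‖⁻¹) • midpoint k p = 0 := by
        rw [← h1]
        simp
      exact (smul_eq_zero.1 h2).resolve_left h0
    · intro h
      rw [h, smul_zero] at h1
      apply Subtype.ext
      exact eq_neg_of_add_eq_zero_right h1
  have hmid0 : midpoint k p = 0 ↔ ∀ i, p (Sum.inl i) = 0 := by
    constructor
    · intro h i
      rw [← midpoint_coe k p i, h]
      rfl
    · intro h
      ext i
      by_cases hi : i = k
      · subst hi
        simp [h]
      · rw [show i = ((⟨i, hi⟩ : {i : Fin (m + 1) // i ≠ k}) : Fin (m + 1)) from rfl,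
          midpoint_coe, h]
        rfl
  rw [chart_apply, mk_mem_antipodal, mem_coordSubspace_normalCoords, hmid, hmid0]
  refine and_congr_right fun hp => ?_
  have hup (i : Fin (m + 1)) : (upperPoint k p : Ambient m) i = 0 ↔ direction k p i = 0 := by
    have h1 : (upperPoint k p : Ambient m) =
        ‖midpoint k p + direction k p‖⁻¹ • (midpoint k p + direction k p) := rfl
    have h2 := norm_ne_zero_iff.2 (midpoint_add_direction_ne_zero k p)
    rw [h1, hmid0.2 hp, zero_add] at *
    simp [h2]
  simp only [hup]
  constructor
  · intro h i hi
    rw [← direction_coe k p i]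
    exact h i hi
  · intro h i hi
    have hik : i ≠ k := by
      rintro rfl
      omega
    exact (direction_coe k p ⟨i, hik⟩).trans (h ⟨i, hik⟩ hi)

lemma image_chart_compl {k : Fin (m + 1)} {j : ℕ} (hkj : k < j) :
    chart k '' (coordSubspace (normalCoords k j))ᶜ = separated k ∩ (antipodal m j)ᶜ := by
  ext z
  rw [← range_chart]
  constructor
  · rintro ⟨p, hp, rfl⟩
    exact ⟨⟨p, rfl⟩, fun h => hp ((chart_mem_antipodal_iff hkj).1 h)⟩
  · rintro ⟨⟨p, rfl⟩, hp⟩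
    exact ⟨p, fun h => hp ((chart_mem_antipodal_iff hkj).2 h), rfl⟩

lemma card_normalCoords {k : Fin (m + 1)} {j : ℕ} (hkj : k < j) (hj : j ≤ m + 1) :
    (normalCoords k j).card + j = 2 * m + 1 := by
  have h1 : (Finset.univ : Finset {i : Fin (m + 1) // i ≠ k}).card = m := by
    rw [Finset.card_univ, Fintype.card_subtype_compl, Fintype.card_fin, Fintype.card_subtype_eq]
    rfl
  have h2 : ((Finset.univ : Finset {i : Fin (m + 1) // i ≠ k}).filter
      fun i : {i : Fin (m + 1) // i ≠ k} => j ≤ (i : Fin (m + 1))).card = m + 1 - j := by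
    rw [← Finset.card_map (Function.Embedding.subtype _)]
    have : ((Finset.univ : Finset {i : Fin (m + 1) // i ≠ k}).filter
      fun i : {i : Fin (m + 1) // i ≠ k} => j ≤ (i : Fin (m + 1))).map
        (Function.Embedding.subtype _) =
        (Finset.univ : Finset (Fin (m + 1))).filter fun i : Fin (m + 1) => j ≤ i := by
      ext i
      simp only [Finset.mem_map, Finset.mem_filter, Finset.mem_univ, true_and,
        Function.Embedding.coe_subtype, Subtype.exists, exists_and_right, exists_eq_right]
      constructor
      · rintro ⟨-, h⟩
        exact h
      · intro h
        refine ⟨?_, h⟩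
        rintro rfl
        omega
    rw [this]
    have h3 : ((Finset.univ : Finset (Fin (m + 1))).filter fun i : Fin (m + 1) => j ≤ i).card =
        (Finset.Ico j (m + 1)).card := by
      rw [← Finset.card_map Fin.valEmbedding]
      congr 1
      ext i
      simp only [Finset.mem_map, Finset.mem_filter, Finset.mem_univ, true_and, Finset.mem_Ico,
        Fin.valEmbedding_apply]
      constructor
      · rintro ⟨a, h, rfl⟩
        exact ⟨h, a.2⟩
      · rintro ⟨h, h'⟩
        exact ⟨⟨i, h'⟩, h, rfl⟩
    rw [h3, Nat.card_Ico]
  rw [normalCoords, Finset.card_disjSum, h1, h2]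
  omega

lemma sameHomology_separated {k : Fin (m + 1)} {j : ℕ} (hkj : k < j) (q : ℕ) :
    SameHomology Set.univ (coordSubspace (normalCoords k j))ᶜ q
      (separated k) (separated k ∩ (antipodal m j)ᶜ) q := by
  rw [← image_chart_compl hkj, ← range_chart, ← Set.image_univ]
  exact sameHomology_image (isOpenEmbedding_chart k).isEmbedding _ _ q

lemma sameHomology_antipodal_compl (k : Fin (m + 1)) (q : ℕ) :
    SameHomology (separated k) (separated k ∩ (antipodal m (k + 1))ᶜ) q
      (antipodal m k)ᶜ (antipodal m (k + 1))ᶜ q := by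
  rw [← separated_union]
  exact sameHomology_excision (isOpen_separated k) (isClosed_antipodal m _).isOpen_compl q

lemma oneDim_separated {k : Fin (m + 1)} {j : ℕ} (hkj : k < j) (hj : j ≤ m + 1) :
    OneDim (separated k) (separated k ∩ (antipodal m j)ᶜ) (2 * m + 1 - j) := by
  have h := (sameHomology_separated hkj _).hasTwoClasses
    (oneDim_and_acyclic_coordSubspace (normalCoords k j)).1
  have hc := card_normalCoords hkj hj
  rwa [show (normalCoords k j).card = 2 * m + 1 - j by omega] at h

/-- The `k`-th step of the filtration has one-dimensional homology, in degree `2 * m - k`. -/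
lemma oneDim_antipodal_compl {k : ℕ} (hk : k ≤ m) :
    OneDim (antipodal m k)ᶜ (antipodal m (k + 1))ᶜ (2 * m - k) := by
  have h := (sameHomology_antipodal_compl (m := m) ⟨k, by omega⟩ _).hasTwoClasses
    (oneDim_separated (k := ⟨k, by omega⟩) (j := k + 1) (Nat.lt_succ_self k) (by omega))
  rwa [show 2 * m + 1 - (k + 1) = 2 * m - k by omega] at h

lemma acyclic_antipodal_compl {k : ℕ} (hk : k ≤ m) {q : ℕ} (hq : q ≠ 2 * m - k) :
    Acyclic (antipodal m k)ᶜ (antipodal m (k + 1))ᶜ q := by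
  refine (sameHomology_antipodal_compl (m := m) ⟨k, by omega⟩ _).le
    ((sameHomology_separated (Nat.lt_succ_self k) _).le
      ((oneDim_and_acyclic_coordSubspace (normalCoords _ (k + 1))).2 q ?_))
  have hc := card_normalCoords (k := (⟨k, by omega⟩ : Fin (m + 1))) (j := k + 1)
    (Nat.lt_succ_self k) (by omega)
  omega

/-! ### Reflections of the sphere -/

/-- The reflection of the Euclidean space which changes the sign of the `l`-th coordinate. -/
noncomputable def reflect (l : Fin (m + 1)) (x : Ambient m) : Ambient m :=
  WithLp.toLp 2 fun i => if i = l then -x i else x i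

@[simp] lemma reflect_apply (l : Fin (m + 1)) (x : Ambient m) (i : Fin (m + 1)) :
    reflect l x i = if i = l then -x i else x i := rfl

lemma norm_reflect (l : Fin (m + 1)) (x : Ambient m) : ‖reflect l x‖ = ‖x‖ := by
  rw [EuclideanSpace.norm_eq, EuclideanSpace.norm_eq]
  congr 1
  refine Finset.sum_congr rfl fun i _ => ?_
  rw [reflect_apply]
  split_ifs <;> simp

/-- The reflection as a self-map of the sphere. -/
noncomputable def sphereReflect (l : Fin (m + 1)) (x : unitSphere m) : unitSphere m :=
  ⟨reflect l x, by rw [mem_sphere_zero_iff_norm, norm_reflect, norm_eq_of_mem_sphere]⟩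

lemma continuous_sphereReflect (l : Fin (m + 1)) : Continuous (sphereReflect (m := m) l) := by
  refine Continuous.subtype_mk ((PiLp.continuous_toLp 2 _).comp (continuous_pi fun i => ?_)) _
  by_cases h : i = l
  · simp only [h, if_true]
    fun_prop
  · simp only [h, if_false]
    fun_prop

lemma sphereReflect_sphereReflect (l : Fin (m + 1)) (x : unitSphere m) :
    sphereReflect l (sphereReflect l x) = x := by
  apply Subtype.ext
  ext i
  change (reflect l (reflect l x)) i = (x : Ambient m) i
  rw [reflect_apply, reflect_apply]
  split_ifs <;> simp

lemma sphereReflect_neg (l : Fin (m + 1)) (x : unitSphere m) :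
    sphereReflect l (-x) = -sphereReflect l x := by
  apply Subtype.ext
  ext i
  change reflect l (-(x : Ambient m)) i = -(reflect l x i)
  rw [reflect_apply, reflect_apply]
  split_ifs <;> simp

/-- The reflection acting on unordered pairs. -/
noncomputable def pairReflect (l : Fin (m + 1)) : C(Sym2 (unitSphere m), Sym2 (unitSphere m)) where
  toFun := Sym2.map (sphereReflect l)
  continuous_toFun := by
    rw [(Sym2.isOpenQuotientMap_mk (X := unitSphere m)).isQuotientMap.continuous_iff]
    exact Sym2.continuous_mk.comp
      ((continuous_sphereReflect l).prodMap (continuous_sphereReflect l))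

lemma pairReflect_mk (l : Fin (m + 1)) (x y : unitSphere m) :
    pairReflect l s(x, y) = s(sphereReflect l x, sphereReflect l y) := rfl

lemma pairReflect_pairReflect (l : Fin (m + 1)) (z : Sym2 (unitSphere m)) :
    pairReflect l (pairReflect l z) = z := by
  induction z using Sym2.inductionOn with
  | _ x y => rw [pairReflect_mk, pairReflect_mk, sphereReflect_sphereReflect,
      sphereReflect_sphereReflect]

lemma mapsTo_pairReflect_antipodal (l : Fin (m + 1)) (j : ℕ) :
    Set.MapsTo (pairReflect l) (antipodal m j) (antipodal m j) := by
  rintro _ ⟨x, rfl, hx⟩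
  refine ⟨sphereReflect l x, by rw [pairReflect_mk, sphereReflect_neg], fun i hi => ?_⟩
  change reflect l x i = 0
  rw [reflect_apply, hx i hi]
  simp

lemma mapsTo_pairReflect_antipodal_compl (l : Fin (m + 1)) (j : ℕ) :
    Set.MapsTo (pairReflect l) (antipodal m j)ᶜ (antipodal m j)ᶜ := by
  intro z hz h
  have := mapsTo_pairReflect_antipodal l j h
  rw [pairReflect_pairReflect] at this
  exact hz this

/-- The reflection in chart coordinates. -/
def chartReflect {k : Fin (m + 1)} (l : {i : Fin (m + 1) // i ≠ k}) (p : ChartIndex k → ℝ) :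
    ChartIndex k → ℝ :=
  fun i => if i = Sum.inl l ∨ i = Sum.inr l then -p i else p i

lemma direction_chartReflect {k : Fin (m + 1)} (l : {i : Fin (m + 1) // i ≠ k})
    (p : ChartIndex k → ℝ) :
    direction k (chartReflect l p) = reflect (l : Fin (m + 1)) (direction k p) := by
  ext i
  rw [reflect_apply]
  by_cases hi : i = k
  · subst hi
    rw [if_neg l.2.symm, direction_self, direction_self]
  · rw [show i = ((⟨i, hi⟩ : {i : Fin (m + 1) // i ≠ k}) : Fin (m + 1)) from rfl, direction_coe,
      direction_coe]
    simp [chartReflect, Subtype.ext_iff]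

lemma midpoint_chartReflect {k : Fin (m + 1)} (l : {i : Fin (m + 1) // i ≠ k})
    (p : ChartIndex k → ℝ) :
    midpoint k (chartReflect l p) = reflect (l : Fin (m + 1)) (midpoint k p) := by
  ext i
  rw [reflect_apply]
  by_cases hi : i = k
  · subst hi
    rw [if_neg l.2.symm, midpoint_self, midpoint_self]
    congr 1
    refine Finset.sum_congr rfl fun j _ => ?_
    by_cases hj : j = l
    · subst hj
      simp [chartReflect]
    · simp [chartReflect, hj]
  · rw [show i = ((⟨i, hi⟩ : {i : Fin (m + 1) // i ≠ k}) : Fin (m + 1)) from rfl, midpoint_coe,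
      midpoint_coe]
    simp [chartReflect, Subtype.ext_iff]

lemma pairReflect_chart {k : Fin (m + 1)} (l : {i : Fin (m + 1) // i ≠ k})
    (p : ChartIndex k → ℝ) :
    pairReflect (l : Fin (m + 1)) (chart k p) = chart k (chartReflect l p) := by
  rw [chart_apply, chart_apply, pairReflect_mk]
  have hnorm : ‖midpoint k (chartReflect l p) + direction k (chartReflect l p)‖ =
      ‖midpoint k p + direction k p‖ := by
    rw [← norm_reflect (l : Fin (m + 1)) (midpoint k p + direction k p), direction_chartReflect,
      midpoint_chartReflect]
    congr 1
    ext i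
    simp only [PiLp.add_apply, reflect_apply]
    split_ifs
    · ring
    · rfl
  have h1 : sphereReflect l (upperPoint k p) = upperPoint k (chartReflect l p) := by
    apply Subtype.ext
    change reflect (l : Fin (m + 1)) (upperPoint k p : Ambient m) = _
    rw [upperPoint, upperPoint, coe_normalize, coe_normalize, hnorm, direction_chartReflect,
      midpoint_chartReflect]
    ext i
    simp only [PiLp.add_apply, PiLp.smul_apply, reflect_apply, smul_eq_mul]
    split_ifs
    · ring
    · rfl
  have h2 : sphereReflect l (lowerPoint k p) = lowerPoint k (chartReflect l p) := by
    apply Subtype.ext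
    change reflect (l : Fin (m + 1)) (lowerPoint k p : Ambient m) = _
    rw [lowerPoint, lowerPoint, coe_normalize, coe_normalize, norm_midpoint_sub_direction,
      norm_midpoint_sub_direction, hnorm, direction_chartReflect, midpoint_chartReflect]
    ext i
    simp only [PiLp.sub_apply, PiLp.smul_apply, reflect_apply, smul_eq_mul]
    split_ifs
    · ring
    · rfl
  rw [h1, h2]

lemma mapsTo_pairReflect_halfCompl {k : Fin (m + 1)} (l : {i : Fin (m + 1) // i ≠ k})
    (s : Finset (ChartIndex k)) (ε : ℝ) :
    Set.MapsTo (pairReflect (l : Fin (m + 1))) (chart k '' halfCompl s (Sum.inr l) ε)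
      (chart k '' halfCompl s (Sum.inr l) (-ε)) := by
  rintro _ ⟨p, hp, rfl⟩
  refine ⟨chartReflect l p, fun h => ?_, (pairReflect_chart l p).symm⟩
  have hs : p ∈ coordSubspace s := by
    intro i hi
    have := h i hi
    rw [chartReflect] at this
    split_ifs at this
    · exact neg_eq_zero.1 this
    · exact this
  have h1 := hp hs
  simpa [chartReflect] using h1

/-! ### Symmetric square relative to the complement of the antipodal pairs -/

/-- The connecting homomorphism between successive steps of the filtration vanishes. In the chart,
the reflection in the coordinate `k + 1` exchanges the two half-spaces into which
`antipodal m (k + 1)` divides `antipodal m (k + 2)`. -/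
lemma bdry_mem_relBoundaries_antipodal {k : ℕ} (hk : k < m) {n : ℕ} (hn : n + 1 = 2 * m - k)
    {c : SingChain (Sym2 (unitSphere m)) (n + 1 + 1)}
    (hc : c ∈ relCycles (antipodal m k)ᶜ (antipodal m (k + 1))ᶜ (n + 1)) :
    bdry (n + 1) c ∈ relBoundaries (antipodal m (k + 1))ᶜ (antipodal m (k + 2))ᶜ n := by
  let κ : Fin (m + 1) := ⟨k, by omega⟩
  let l : {i : Fin (m + 1) // i ≠ κ} := ⟨⟨k + 1, by omega⟩, by simp [κ, Fin.ext_iff]⟩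
  have hins : insert (Sum.inr l) (normalCoords κ (k + 2)) = normalCoords κ (k + 1) := by
    ext i
    rcases i with i | i
    · simp [normalCoords]
    · have h1 : i = l ↔ ((i : Fin (m + 1)) : ℕ) = k + 1 := by
        rw [Subtype.ext_iff, Fin.ext_iff]
      simp only [normalCoords, Finset.mem_insert, Sum.inr.injEq, Finset.inr_mem_disjSum,
        Finset.mem_filter, Finset.mem_univ, true_and, h1]
      omega
  have hnot : Sum.inr l ∉ normalCoords κ (k + 2) := by simp [normalCoords, l]
  let A := chart κ '' halfCompl (normalCoords κ (k + 2)) (Sum.inr l) 1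
  let B := chart κ '' halfCompl (normalCoords κ (k + 2)) (Sum.inr l) (-1)
  have hAB : A ∪ B = separated κ ∩ (antipodal m (k + 1))ᶜ := by
    rw [← Set.image_union, halfCompl_union, hins, image_chart_compl (Nat.lt_succ_self k)]
  have hAB' : A ∩ B = separated κ ∩ (antipodal m (k + 2))ᶜ := by
    rw [← Set.image_inter (isOpenEmbedding_chart κ).injective, halfCompl_inter,
      image_chart_compl (by simp [κ])]
  have hopen := (isOpenEmbedding_chart κ).isOpenMap
  have hsep (S : Set (ChartIndex κ → ℝ)) : chart κ '' S ⊆ separated κ := by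
    rw [← range_chart]
    exact Set.image_subset_range _ _
  have hRsep : Set.MapsTo (pairReflect (l : Fin (m + 1))) (separated κ) (separated κ) := by
    rw [← range_chart]
    rintro _ ⟨p, rfl⟩
    exact ⟨_, (pairReflect_chart l p).symm⟩
  have hOB : Acyclic (separated κ) B (n + 1) := by
    have h := (sameHomology_image (isOpenEmbedding_chart κ).isEmbedding Set.univ
      (halfCompl (normalCoords κ (k + 2)) (Sum.inr l) (-1)) (n + 1)).le
        (acyclic_halfCompl hnot (by norm_num) (n + 1))
    rw [Set.image_univ, range_chart] at h
    exact h
  have hOne : OneDim (separated κ) (A ∩ B) n := by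
    rw [hAB']
    have h := oneDim_separated (k := κ) (j := k + 2) (by simp [κ]) (by omega)
    rwa [show 2 * m + 1 - (k + 2) = n by omega] at h
  have hOneW : OneDim (antipodal m (k + 1))ᶜ (antipodal m (k + 2))ᶜ n := by
    have h := oneDim_antipodal_compl (m := m) (k := k + 1) (by omega)
    rwa [show 2 * m - (k + 1) = n by omega] at h
  -- By excision the cycle may be assumed to lie in the chart.
  rw [← separated_union κ] at hc
  obtain ⟨c', hc', hcc'⟩ := exists_relCycle_excision (isOpen_separated κ)
    (isClosed_antipodal m (k + 1)).isOpen_compl hc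
  rw [← hAB] at hc'
  have h1 := bdry_mem_relBoundaries_of_involution (pairReflect_pairReflect (l : Fin (m + 1)))
    (hopen _ (isOpen_halfCompl _ _ _)) (hopen _ (isOpen_halfCompl _ _ _)) (hsep _) (hsep _) hRsep
    (mapsTo_pairReflect_halfCompl l (normalCoords κ (k + 2)) 1)
    (by simpa using mapsTo_pairReflect_halfCompl l (normalCoords κ (k + 2)) (-1))
    (mapsTo_pairReflect_antipodal_compl _ _) (mapsTo_pairReflect_antipodal_compl _ _)
    (hAB.subset.trans Set.inter_subset_right) (hAB'.subset.trans Set.inter_subset_right)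
    hOne hOB hOneW hc'
  obtain ⟨e, -, hw⟩ := mem_relBoundaries.1 hcc'
  have h2 : bdry (n + 1) c = bdry (n + 1) (c + c' + bdry (n + 1 + 1) e) + bdry (n + 1) c' := by
    have := ZModModule.add_self (bdry (n + 1) c')
    rw [map_add, map_add, bdry_bdry, add_zero, add_assoc (bdry (n + 1) c), this, add_zero]
  rw [h2]
  exact Submodule.add_mem _ (Submodule.mem_sup_right ⟨_, hw, rfl⟩) h1

/-- The homology relative to the complement of all antipodal pairs. -/
lemma oneDim_and_acyclic_antipodal_compl (m : ℕ) :
    (∀ q, m ≤ q → q ≤ 2 * m → OneDim Set.univ (antipodal m (m + 1))ᶜ q) ∧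
      ∀ q, ¬ (m ≤ q ∧ q ≤ 2 * m) → Acyclic Set.univ (antipodal m (m + 1))ᶜ q := by
  obtain ⟨h1, h2⟩ := oneDim_and_acyclic_of_filtration (W := fun k => (antipodal m k)ᶜ)
    (d := 2 * m) (m := m) (by omega) (by simp [antipodal_zero])
    (fun k => Set.compl_subset_compl.2 (antipodal_mono (Nat.le_succ k)))
    (fun k hk => oneDim_antipodal_compl hk) (fun k hk q hq => acyclic_antipodal_compl hk hq)
    (fun k hk n hn c hc => bdry_mem_relBoundaries_antipodal hk hn hc) (m + 1) le_rfl
  exact ⟨fun q hq hq' => h1 q (by omega) hq', fun q hq => h2 q (by omega)⟩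

end SphereSquare

/-! ### The deformation onto the diagonal -/

namespace SphereSquare

open SingChain

variable {m : ℕ}

/-- The ordered pairs of points which are not antipodal. -/
abbrev NonAntipodal (m : ℕ) : Type := {p : unitSphere m × unitSphere m // p.2 ≠ -p.1}

/-- The segment from `x` to the midpoint of `x` and `y`. -/
noncomputable def halfSegment (t : unitInterval) (x y : Ambient m) : Ambient m :=
  (1 - t / 2 : ℝ) • x + (t / 2 : ℝ) • y

lemma halfSegment_ne_zero (t : unitInterval) {x y : unitSphere m} (h : y ≠ -x) :
    halfSegment t (x : Ambient m) (y : Ambient m) ≠ 0 := by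
  intro h0
  have h1 : (1 - t / 2 : ℝ) • (x : Ambient m) = -((t / 2 : ℝ) • (y : Ambient m)) :=
    eq_neg_of_add_eq_zero_left h0
  have h2 := congrArg norm h1
  have ht0 := t.2.1
  have ht1 := t.2.2
  rw [norm_neg, norm_smul, norm_smul, norm_eq_of_mem_sphere, norm_eq_of_mem_sphere,
    Real.norm_of_nonneg (by linarith), Real.norm_of_nonneg (by linarith)] at h2
  have h3 : (t : ℝ) = 1 := by linarith
  apply h
  apply Subtype.ext
  change (y : Ambient m) = -(x : Ambient m)
  rw [h3, ← smul_neg, show (1 - 1 / 2 : ℝ) = 1 / 2 by norm_num] at h1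
  rw [smul_right_injective _ (by norm_num : (1 / 2 : ℝ) ≠ 0) h1, neg_neg]

lemma ne_neg_symm {x y : unitSphere m} (h : y ≠ -x) : x ≠ -y := fun h' => h (by rw [h', neg_neg])

/-- The point of the sphere in the direction of `halfSegment t x y`. -/
noncomputable def moveToMidpoint (t : unitInterval) (x y : unitSphere m) (h : y ≠ -x) :
    unitSphere m :=
  normalize (halfSegment t (x : Ambient m) (y : Ambient m)) (halfSegment_ne_zero t h)

lemma norm_halfSegment_comm (t : unitInterval) (x y : unitSphere m) :
    ‖halfSegment t (x : Ambient m) (y : Ambient m)‖ =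
      ‖halfSegment t (y : Ambient m) (x : Ambient m)‖ := by
  have h (x y : unitSphere m) : ‖halfSegment t (x : Ambient m) (y : Ambient m)‖ ^ 2 =
      (1 - t / 2 : ℝ) ^ 2 + 2 * ((1 - t / 2) * (t / 2) * inner ℝ (x : Ambient m) (y : Ambient m)) +
        (t / 2 : ℝ) ^ 2 := by
    rw [halfSegment, norm_add_sq_real, norm_smul, norm_smul, norm_eq_of_mem_sphere,
      norm_eq_of_mem_sphere, inner_smul_left, inner_smul_right, mul_one, mul_one, Real.norm_eq_abs,
      Real.norm_eq_abs, sq_abs, sq_abs, conj_trivial]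
    ring
  rw [← sq_eq_sq₀ (norm_nonneg _) (norm_nonneg _), h, h, real_inner_comm]

lemma moveToMidpoint_ne_neg (t : unitInterval) {x y : unitSphere m} (h : y ≠ -x) :
    moveToMidpoint t y x (ne_neg_symm h) ≠ -moveToMidpoint t x y h := by
  intro h0
  have h1 : (moveToMidpoint t y x (ne_neg_symm h) : Ambient m) = -(moveToMidpoint t x y h) :=
    congrArg Subtype.val h0
  rw [moveToMidpoint, moveToMidpoint, coe_normalize, coe_normalize, norm_halfSegment_comm,
    ← smul_neg] at h1
  have h2 := smul_right_injective _
    (inv_ne_zero (norm_ne_zero_iff.2 (halfSegment_ne_zero t h))) h1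
  apply h
  apply Subtype.ext
  change (y : Ambient m) = -(x : Ambient m)
  have h3 : (y : Ambient m) + (x : Ambient m) =
      halfSegment t (y : Ambient m) (x : Ambient m) +
        halfSegment t (x : Ambient m) (y : Ambient m) := by
    rw [halfSegment, halfSegment]
    module
  rw [h2, neg_add_cancel] at h3
  exact eq_neg_of_add_eq_zero_left h3

lemma moveToMidpoint_zero {x y : unitSphere m} (h : y ≠ -x) : moveToMidpoint 0 x y h = x :=
  normalize_eq _ one_pos (by simp [halfSegment])

lemma moveToMidpoint_one {x y : unitSphere m} (h : y ≠ -x) :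
    moveToMidpoint 1 x y h = moveToMidpoint 1 y x (ne_neg_symm h) := by
  have h1 : halfSegment 1 (x : Ambient m) (y : Ambient m) =
      halfSegment 1 (y : Ambient m) (x : Ambient m) := by
    simp only [halfSegment, Set.Icc.coe_one]
    module
  simp only [moveToMidpoint, h1]

lemma mk_mem_antipodal_compl {x y : unitSphere m} : s(x, y) ∈ (antipodal m (m + 1))ᶜ ↔ y ≠ -x := by
  rw [Set.mem_compl_iff, mk_mem_antipodal, not_iff_not, and_iff_left_iff_imp]
  intro _ i hi
  omega

/-- The quotient map from ordered to unordered pairs which are not antipodal. -/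
def nonAntipodalMk (p : NonAntipodal m) : ((antipodal m (m + 1))ᶜ : Set (Sym2 (unitSphere m))) :=
  ⟨s(p.1.1, p.1.2), mk_mem_antipodal_compl.2 p.2⟩

lemma isOpenQuotientMap_nonAntipodalMk : IsOpenQuotientMap (nonAntipodalMk (m := m)) where
  surjective := by
    rintro ⟨z, hz⟩
    induction z using Sym2.inductionOn with
    | _ x y => exact ⟨⟨(x, y), mk_mem_antipodal_compl.1 hz⟩, rfl⟩
  continuous := Continuous.subtype_mk (Sym2.continuous_mk.comp continuous_subtype_val) _
  isOpenMap := by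
    have hN := (isClosed_antipodal m (m + 1)).isOpen_compl
    have ho : IsOpen {p : unitSphere m × unitSphere m | p.2 ≠ -p.1} :=
      isOpen_ne_fun (by fun_prop) (by fun_prop)
    rw [hN.isOpenEmbedding_subtypeVal.isOpenMap_iff]
    exact Sym2.isOpenMap_mk.comp ho.isOpenMap_subtype_val

lemma continuous_halfSegment {Y : Type*} [TopologicalSpace Y] {t : Y → unitInterval}
    {x y : Y → Ambient m} (ht : Continuous t) (hx : Continuous x) (hy : Continuous y) :
    Continuous fun p => halfSegment (t p) (x p) (y p) := by
  have ht' : Continuous fun p => ((t p : ℝ) / 2) :=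
    (continuous_subtype_val.comp ht).div_const 2
  exact ((continuous_const.sub ht').smul hx).add (ht'.smul hy)

lemma continuous_moveToMidpoint : Continuous fun p : NonAntipodal m × unitInterval =>
    moveToMidpoint p.2 p.1.1.1 p.1.1.2 p.1.2 :=
  continuous_normalize (f := fun p : NonAntipodal m × unitInterval =>
    halfSegment p.2 (p.1.1.1 : Ambient m) (p.1.1.2 : Ambient m))
    (continuous_halfSegment (by fun_prop) (by fun_prop) (by fun_prop))
    fun p => halfSegment_ne_zero p.2 p.1.2

lemma continuous_moveToMidpoint_swap : Continuous fun p : NonAntipodal m × unitInterval =>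
    moveToMidpoint p.2 p.1.1.2 p.1.1.1 (ne_neg_symm p.1.2) :=
  continuous_normalize (f := fun p : NonAntipodal m × unitInterval =>
    halfSegment p.2 (p.1.1.2 : Ambient m) (p.1.1.1 : Ambient m))
    (continuous_halfSegment (by fun_prop) (by fun_prop) (by fun_prop))
    fun p => halfSegment_ne_zero p.2 (ne_neg_symm p.1.2)

/-- Moving both points of an ordered pair to their midpoint on the sphere. -/
noncomputable def orderedDeformation : C(NonAntipodal m × unitInterval, Sym2 (unitSphere m)) where
  toFun p := s(moveToMidpoint p.2 p.1.1.1 p.1.1.2 p.1.2,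
    moveToMidpoint p.2 p.1.1.2 p.1.1.1 (ne_neg_symm p.1.2))
  continuous_toFun :=
    Sym2.continuous_mk.comp (continuous_moveToMidpoint.prodMk continuous_moveToMidpoint_swap)

/-- The quotient map of the cylinders. -/
def nonAntipodalMkProd : C(NonAntipodal m × unitInterval,
    ((antipodal m (m + 1))ᶜ : Set (Sym2 (unitSphere m))) × unitInterval) :=
  ⟨Prod.map nonAntipodalMk id,
    (isOpenQuotientMap_nonAntipodalMk.prodMap IsOpenQuotientMap.id).continuous⟩

lemma exists_deformation (m : ℕ) :
    ∃ h : C(((antipodal m (m + 1))ᶜ : Set (Sym2 (unitSphere m))) × unitInterval,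
      Sym2 (unitSphere m)), ∀ (p : NonAntipodal m) (t : unitInterval),
        h (nonAntipodalMk p, t) = orderedDeformation (p, t) := by
  have hq : Topology.IsQuotientMap (nonAntipodalMkProd (m := m)) :=
    (isOpenQuotientMap_nonAntipodalMk.prodMap IsOpenQuotientMap.id).isQuotientMap
  have hcomp : ∀ a b, nonAntipodalMkProd (m := m) a = nonAntipodalMkProd b →
      orderedDeformation a = orderedDeformation b := by
    rintro ⟨⟨⟨x, y⟩, h⟩, t⟩ ⟨⟨⟨x', y'⟩, h'⟩, t'⟩ hab
    obtain ⟨h1, h2⟩ := Prod.ext_iff.1 hab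
    obtain rfl : t = t' := h2
    rcases Sym2.eq_iff.1 (congrArg Subtype.val h1) with ⟨rfl, rfl⟩ | ⟨rfl, rfl⟩
    · rfl
    · exact Sym2.eq_swap
  refine ⟨hq.lift orderedDeformation hcomp, fun p t => ?_⟩
  exact DFunLike.congr_fun (hq.lift_comp orderedDeformation hcomp) (p, t)

lemma diagSet_subset_antipodal_compl :
    (Sym2.diagSet : Set (Sym2 (unitSphere m))) ⊆ (antipodal m (m + 1))ᶜ := by
  intro z hz
  induction z using Sym2.inductionOn with
  | _ x y =>
    obtain rfl : x = y := hz
    exact mk_mem_antipodal_compl.2 (ne_neg_of_mem_unit_sphere ℝ x)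

/-- The unordered pairs which are not antipodal deform onto the diagonal. -/
lemma acyclic_antipodal_compl_diagSet (m q : ℕ) :
    Acyclic (antipodal m (m + 1))ᶜ (Sym2.diagSet : Set (Sym2 (unitSphere m))) q := by
  obtain ⟨h, hh⟩ := exists_deformation m
  refine acyclic_of_homotopy diagSet_subset_antipodal_compl h (fun a => ?_) (fun a => ?_)
    (fun a => ?_) (fun a t ha => ?_) q
  · obtain ⟨p, rfl⟩ := isOpenQuotientMap_nonAntipodalMk.surjective a
    rw [hh]
    change s(_, _) = s(_, _)
    rw [moveToMidpoint_zero, moveToMidpoint_zero]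
  · obtain ⟨a, t⟩ := a
    obtain ⟨p, rfl⟩ := isOpenQuotientMap_nonAntipodalMk.surjective a
    rw [hh]
    exact mk_mem_antipodal_compl.2 (moveToMidpoint_ne_neg t p.2)
  · obtain ⟨p, rfl⟩ := isOpenQuotientMap_nonAntipodalMk.surjective a
    rw [hh]
    exact moveToMidpoint_one p.2
  · obtain ⟨⟨⟨x, y⟩, hp⟩, rfl⟩ := isOpenQuotientMap_nonAntipodalMk.surjective a
    obtain rfl : x = y := ha
    rw [hh]
    rfl

/-- The homology of the symmetric square of the sphere relative to the diagonal. -/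
theorem oneDim_and_acyclic_diagSet (m : ℕ) :
    (∀ q, m ≤ q → q ≤ 2 * m →
      OneDim Set.univ (Sym2.diagSet : Set (Sym2 (unitSphere m))) q) ∧
    ∀ q, ¬ (m ≤ q ∧ q ≤ 2 * m) →
      Acyclic Set.univ (Sym2.diagSet : Set (Sym2 (unitSphere m))) q := by
  have hsame (q : ℕ) := (sameHomology_of_acyclic (q := q)
    (diagSet_subset_antipodal_compl (m := m)) (Set.subset_univ _)
    (acyclic_antipodal_compl_diagSet m q) fun p _ c hc =>
      acyclic_antipodal_compl_diagSet m p ⟨hc.2, by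
        rw [SetLike.mem_coe, Submodule.mem_comap, bdry_bdry]
        exact zero_mem _⟩).symm
  obtain ⟨h1, h2⟩ := oneDim_and_acyclic_antipodal_compl m
  exact ⟨fun q hq hq' => (hsame q).hasTwoClasses (h1 q hq hq'), fun q hq => (hsame q).le (h2 q hq)⟩

end SphereSquare

/-! ### Comparison with the singular chain complex of Mathlib -/

namespace SingChain

/-- The singular chain complex of a space with coefficients in `ZMod 2`. -/
noncomputable abbrev singularComplex (X : TopCat.{0}) : ChainComplex (ModuleCat.{0} (ZMod 2)) ℕ :=
  (TopCat.toSSet.obj X).chainComplex (ModuleCat.of (ZMod 2) (ZMod 2))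

/-- The map of singular chain complexes induced by a continuous map. -/
noncomputable abbrev singularComplexMap {X Y : TopCat.{0}} (f : X ⟶ Y) :
    singularComplex X ⟶ singularComplex Y :=
  SSet.chainComplexMap (TopCat.toSSet.map f) (ModuleCat.of (ZMod 2) (ZMod 2))

variable (X : TopCat.{0}) (n : ℕ)

/-- A singular simplex as a basis element of the singular chain complex. -/
noncomputable def simplexChain (σ : C(stdSimplex ℝ (Fin (n + 1)), X)) : (singularComplex X).X n :=
  ((TopCat.toSSet.obj X).ιChainComplex (R := ModuleCat.of (ZMod 2) (ZMod 2))
    ((X.toSSetObjEquiv (.op (.mk n))).symm σ)).hom (1 : ZMod 2)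

/-- The comparison map. -/
noncomputable def toSingularComplex : SingChain X (n + 1) →ₗ[ZMod 2] (singularComplex X).X n :=
  Finsupp.linearCombination (ZMod 2) (simplexChain X n)

/-- The inverse of the comparison map, by the universal property of the coproduct. -/
noncomputable def ofSingularComplex :
    (singularComplex X).X n ⟶ ModuleCat.of (ZMod 2) (SingChain X (n + 1)) :=
  Cofan.IsColimit.desc ((TopCat.toSSet.obj X).isColimitChainComplexXCofan
      (ModuleCat.of (ZMod 2) (ZMod 2)) n) fun x =>
    ModuleCat.ofHom (LinearMap.toSpanSingleton (ZMod 2) (SingChain X (n + 1))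
      (Finsupp.single (X.toSSetObjEquiv _ x) 1))

variable {X n}

@[simp] lemma toSingularComplex_single (σ : C(stdSimplex ℝ (Fin (n + 1)), X)) :
    toSingularComplex X n (Finsupp.single σ 1) = simplexChain X n σ := by
  simp [toSingularComplex]

lemma ι_ofSingularComplex (x : (TopCat.toSSet.obj X).obj (.op (.mk n))) :
    (TopCat.toSSet.obj X).ιChainComplex (R := ModuleCat.of (ZMod 2) (ZMod 2)) x ≫
      ofSingularComplex X n = ModuleCat.ofHom (LinearMap.toSpanSingleton (ZMod 2)
        (SingChain X (n + 1)) (Finsupp.single (X.toSSetObjEquiv _ x) 1)) :=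
  Cofan.IsColimit.fac _ _ _

lemma ofSingularComplex_simplexChain (σ : C(stdSimplex ℝ (Fin (n + 1)), X)) :
    (ofSingularComplex X n).hom (simplexChain X n σ) = Finsupp.single σ 1 := by
  have h := ConcreteCategory.congr_hom
    (ι_ofSingularComplex ((X.toSSetObjEquiv (.op (.mk n))).symm σ)) (1 : ZMod 2)
  refine h.trans ?_
  change (1 : ZMod 2) • Finsupp.single _ _ = _
  rw [one_smul, Equiv.apply_symm_apply]

lemma ofSingularComplex_toSingularComplex (c : SingChain X (n + 1)) :
    (ofSingularComplex X n).hom (toSingularComplex X n c) = c :=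
  ext_single (f := (ofSingularComplex X n).hom ∘ₗ toSingularComplex X n) (g := LinearMap.id)
    (fun σ => by
      rw [LinearMap.comp_apply, toSingularComplex_single]
      exact ofSingularComplex_simplexChain σ) c

lemma toSingularComplex_ofSingularComplex (c : (singularComplex X).X n) :
    toSingularComplex X n ((ofSingularComplex X n).hom c) = c := by
  have h : ofSingularComplex X n ≫ ModuleCat.ofHom (toSingularComplex X n) = 𝟙 _ := by
    refine SSet.chainComplex_hom_ext fun x => ?_
    rw [← Category.assoc, ι_ofSingularComplex, Category.comp_id]
    ext
    change toSingularComplex X n ((1 : ZMod 2) • Finsupp.single _ 1) = _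
    rw [one_smul, toSingularComplex_single, simplexChain, Equiv.symm_apply_apply]
  exact ConcreteCategory.congr_hom h c

lemma bijective_toSingularComplex : Function.Bijective (toSingularComplex X n) :=
  Function.bijective_iff_has_inverse.2 ⟨_, ofSingularComplex_toSingularComplex,
    toSingularComplex_ofSingularComplex⟩

lemma d_toSingularComplex (c : SingChain X (n + 1 + 1)) :
    ((singularComplex X).d (n + 1) n).hom (toSingularComplex X (n + 1) c) =
      toSingularComplex X n (bdry (n + 1) c) := by
  refine ext_single (f := ((singularComplex X).d (n + 1) n).hom ∘ₗ toSingularComplex X (n + 1))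
    (g := toSingularComplex X n ∘ₗ bdry (n + 1)) (fun σ => ?_) c
  rw [LinearMap.comp_apply, LinearMap.comp_apply, toSingularComplex_single, bdry_single, map_sum]
  have h := ConcreteCategory.congr_hom ((TopCat.toSSet.obj X).ιChainComplex_d
    (ModuleCat.of (ZMod 2) (ZMod 2)) ((X.toSSetObjEquiv (.op (.mk (n + 1)))).symm σ)) (1 : ZMod 2)
  refine h.trans ?_
  refine (LinearMap.congr_fun (ModuleCat.hom_sum _ _) _).trans ?_
  rw [LinearMap.sum_apply]
  refine Finset.sum_congr rfl fun i _ => ?_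
  have hs (k : ℕ) (M : ModuleCat.{0} (ZMod 2)) (f : ModuleCat.of (ZMod 2) (ZMod 2) ⟶ M) :
      (-1 : ℤ) ^ k • f = f := by
    have : f + f = 0 := by
      ext
      exact ZModModule.add_self _
    rcases neg_one_pow_eq_or ℤ k with h | h
    · rw [h, one_smul]
    · rw [h, neg_smul, one_smul, neg_eq_of_add_eq_zero_left this]
  rw [hs, toSingularComplex_single]
  rfl

lemma map_toSingularComplex {Y : TopCat.{0}} (f : X ⟶ Y) (c : SingChain X (n + 1)) :
    ((singularComplexMap f).f n).hom (toSingularComplex X n c) =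
      toSingularComplex Y n (map f.hom (n + 1) c) := by
  refine ext_single (f := ((singularComplexMap f).f n).hom ∘ₗ toSingularComplex X n)
    (g := toSingularComplex Y n ∘ₗ map f.hom (n + 1)) (fun σ => ?_) c
  rw [LinearMap.comp_apply, LinearMap.comp_apply, toSingularComplex_single, map_single,
    toSingularComplex_single]
  exact ConcreteCategory.congr_hom (SSet.ι_chainComplexMap_f _ _ (TopCat.toSSet.map f)
    (ModuleCat.of (ZMod 2) (ZMod 2)) ((X.toSSetObjEquiv (.op (.mk n))).symm σ)) (1 : ZMod 2)

end SingChain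

/-! ### Homology of the relative singular chain complex -/

section Homology

variable {S : ShortComplex (ModuleCat.{0} (ZMod 2))}

lemma subsingleton_homology_of_ker_le_range
    (h : LinearMap.ker S.g.hom ≤ LinearMap.range S.f.hom) : Subsingleton S.homology := by
  have hS : S.Exact := S.moduleCat_exact_iff.2 fun x hx => h hx
  exact ModuleCat.subsingleton_of_isZero (S.exact_iff_isZero_homology.1 hS)

/-- Over the field with two elements, a homology module with exactly one nonzero class is
one-dimensional. -/
lemma nonempty_homology_equiv_of_hasTwoClasses
    (h : HasTwoClasses (LinearMap.ker S.g.hom) (LinearMap.range S.f.hom)) :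
    Nonempty (S.homology ≃ₗ[ZMod 2] ZMod 2) := by
  obtain ⟨z, hz, hzN, hall⟩ := h
  have hmem (c : LinearMap.ker S.g.hom) : c ∈ LinearMap.range S.moduleCatToCycles ↔
      (c : S.X₂) ∈ LinearMap.range S.f.hom := by
    constructor
    · rintro ⟨x, rfl⟩
      exact ⟨x, rfl⟩
    · rintro ⟨x, hx⟩
      exact ⟨x, Subtype.ext hx⟩
  let N := LinearMap.range S.moduleCatToCycles
  let f : ZMod 2 →ₗ[ZMod 2] (LinearMap.ker S.g.hom ⧸ N) :=
    LinearMap.toSpanSingleton (ZMod 2) _ (N.mkQ ⟨z, hz⟩)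
  have hz0 : N.mkQ ⟨z, hz⟩ ≠ 0 := fun h0 =>
    hzN ((hmem _).1 ((Submodule.Quotient.mk_eq_zero N).1 h0))
  have hf : Function.Bijective f := by
    constructor
    · rw [injective_iff_map_eq_zero]
      intro a ha
      exact (smul_eq_zero.1 ha).resolve_right hz0
    · intro y
      obtain ⟨c, rfl⟩ := N.mkQ_surjective y
      rcases hall c c.2 with hc | hc
      · refine ⟨0, ?_⟩
        rw [map_zero]
        exact ((Submodule.Quotient.mk_eq_zero N).2 ((hmem _).2 hc)).symm
      · refine ⟨1, ?_⟩
        have h1 : N.mkQ (c + ⟨z, hz⟩) = 0 :=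
          (Submodule.Quotient.mk_eq_zero N).2 ((hmem _).2 hc)
        rw [map_add] at h1
        change (1 : ZMod 2) • N.mkQ ⟨z, hz⟩ = N.mkQ c
        rw [one_smul, ← sub_eq_zero, ZModModule.sub_eq_add, add_comm, h1]
  exact ⟨S.moduleCatHomologyIso.toLinearEquiv.trans (LinearEquiv.ofBijective f hf).symm⟩

end Homology

namespace SingChain

variable {X : Type} [TopologicalSpace X] (A : Set X)

/-- The inclusion of a subspace. -/
abbrev inclusion : TopCat.of A ⟶ TopCat.of X := (TopPair.ofSubset (X := TopCat.of X) A).map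

/-- The class of a chain in the relative singular chain complex. -/
noncomputable def toRelative (n : ℕ) : SingChain X (n + 1) →ₗ[ZMod 2]
    (relativeSingularChainComplex (ZMod 2) (TopPair.ofSubset (X := TopCat.of X) A)).X n :=
  ((cokernel.π (singularComplexMap (inclusion A))).f n).hom ∘ₗ toSingularComplex (TopCat.of X) n

lemma range_map_inclusion (n : ℕ) (c : SingChain X (n + 1)) :
    c ∈ within A (n + 1) ↔ ∃ c', map (inclusion A).hom (n + 1) c' = c := by
  constructor
  · intro hc
    rw [← Subtype.range_coe (s := A), ← Set.image_univ] at hc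
    obtain ⟨c', -, h⟩ := exists_map_eq (f := (inclusion A).hom) Topology.IsEmbedding.subtypeVal hc
    exact ⟨c', h⟩
  · rintro ⟨c', rfl⟩
    exact map_mem (A := Set.univ) (fun x _ => x.2) (mem_within_univ _ c')

lemma toRelative_surjective (n : ℕ) : Function.Surjective (toRelative A n) := by
  have : Epi ((cokernel.π (singularComplexMap (inclusion A))).f n) := inferInstance
  exact ((ModuleCat.epi_iff_surjective _).1 this).comp bijective_toSingularComplex.2

/-- The relative chains are the chains of `X` modulo the chains whose simplices lie in `A`. -/
lemma toRelative_eq_zero_iff (n : ℕ) (c : SingChain X (n + 1)) :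
    toRelative A n c = 0 ↔ c ∈ within A (n + 1) := by
  have hex := (ShortComplex.exact_cokernel (singularComplexMap (inclusion A))).map
    (HomologicalComplex.eval (ModuleCat.{0} (ZMod 2)) (ComplexShape.down ℕ) n)
  rw [ShortComplex.moduleCat_exact_iff] at hex
  rw [range_map_inclusion]
  constructor
  · intro h
    obtain ⟨x, hx⟩ := hex (toSingularComplex (TopCat.of X) n c) h
    obtain ⟨c', rfl⟩ := bijective_toSingularComplex.2 x
    exact ⟨c', bijective_toSingularComplex.1
      ((map_toSingularComplex (inclusion A) c').symm.trans hx)⟩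
  · rintro ⟨c', rfl⟩
    have h := HomologicalComplex.congr_hom (cokernel.condition (singularComplexMap (inclusion A))) n
    have h' := ConcreteCategory.congr_hom h (toSingularComplex (TopCat.of A) n c')
    refine Eq.trans ?_ h'
    exact congrArg ((cokernel.π (singularComplexMap (inclusion A))).f n).hom
      (map_toSingularComplex (inclusion A) c').symm

lemma d_toRelative (n : ℕ) (c : SingChain X (n + 1 + 1)) :
    ((relativeSingularChainComplex (ZMod 2)
      (TopPair.ofSubset (X := TopCat.of X) A)).d (n + 1) n).hom (toRelative A (n + 1) c) =
      toRelative A n (bdry (n + 1) c) := by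
  have h := (cokernel.π (singularComplexMap (inclusion A))).comm (n + 1) n
  have h' := ConcreteCategory.congr_hom h (toSingularComplex (TopCat.of X) (n + 1) c)
  refine h'.trans ?_
  have h2 := d_toSingularComplex (X := TopCat.of X) (n := n) c
  exact congrArg ((cokernel.π (singularComplexMap (inclusion A))).f n).hom h2

/-- The relative cycles and boundaries in terms of chains in the ambient space compute the homology
of the relative singular chain complex. The augmentation of `SingChain` makes no difference, since
every chain without vertices counts as lying in `A`. -/
lemma sameClasses_relativeSingularChainComplex (q : ℕ) :
    let K := relativeSingularChainComplex (ZMod 2) (TopPair.ofSubset (X := TopCat.of X) A)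
    SameClasses (relCycles Set.univ A q) (relBoundaries Set.univ A q)
      (LinearMap.ker (K.d q ((ComplexShape.down ℕ).next q)).hom)
      (LinearMap.range (K.d (q + 1) q).hom) := by
  intro K
  have hker (c : SingChain X (q + 1)) : c ∈ relCycles Set.univ A q ↔
      toRelative A q c ∈ LinearMap.ker (K.d q ((ComplexShape.down ℕ).next q)).hom := by
    rw [mem_relCycles, LinearMap.mem_ker, and_iff_right (mem_within_univ _ _)]
    cases q with
    | zero =>
      -- Both conditions are empty: the only simplex without vertices lies in `A`, and the
      -- differential out of degree zero is zero.
      rw [ChainComplex.next_nat_zero, K.shape 0 0 (by simp)]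
      exact iff_of_true (mem_within_zero _ _) rfl
    | succ n =>
      rw [ChainComplex.next_nat_succ, ← toRelative_eq_zero_iff]
      exact (congrArg (· = 0) (d_toRelative A n c)).to_iff.symm
  refine sameClasses_of_linearMap (toRelative A q) (fun c hc => (hker c).1 hc) (fun c _ => ?_)
    fun c' hc' => ?_
  · have hiff (e : SingChain X (q + 2)) : c + bdry (q + 1) e ∈ within A (q + 1) ↔
        (K.d (q + 1) q).hom (toRelative A (q + 1) e) = toRelative A q c := by
      rw [← toRelative_eq_zero_iff, map_add, ← ZModModule.sub_eq_add, sub_eq_zero, eq_comm]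
      exact (congrArg (· = toRelative A q c) (d_toRelative A q e)).to_iff.symm
    rw [mem_relBoundaries]
    constructor
    · rintro ⟨y, hy⟩
      obtain ⟨e, rfl⟩ := toRelative_surjective A (q + 1) y
      exact ⟨e, mem_within_univ _ _, (hiff e).2 hy⟩
    · rintro ⟨e, -, he⟩
      exact ⟨_, (hiff e).1 he⟩
  · obtain ⟨c, rfl⟩ := toRelative_surjective A q c'
    refine ⟨c, (hker c).2 hc', ?_⟩
    rw [ZModModule.add_self]
    exact zero_mem _

/-- Relative singular homology as the homology of a short complex with explicit differentials. -/
noncomputable def relativeSingularHomologyIso (q : ℕ) :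
    relativeSingularHomology (ZMod 2) (TopPair.ofSubset (X := TopCat.of X) A) q ≅
      ((relativeSingularChainComplex (ZMod 2) (TopPair.ofSubset (X := TopCat.of X) A)).sc' (q + 1) q
        ((ComplexShape.down ℕ).next q)).homology :=
  HomologicalComplex.homologyIsoSc' _ _ _ _ (ChainComplex.prev ℕ q) rfl

lemma Acyclic.subsingleton_homology {q : ℕ} (h : Acyclic Set.univ A q) : Subsingleton
    (relativeSingularHomology (ZMod 2) (TopPair.ofSubset (X := TopCat.of X) A) q) := by
  have h' := (sameClasses_relativeSingularChainComplex A q).le h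
  have := subsingleton_homology_of_ker_le_range (S := (relativeSingularChainComplex (ZMod 2)
    (TopPair.ofSubset (X := TopCat.of X) A)).sc' (q + 1) q ((ComplexShape.down ℕ).next q)) h'
  exact (relativeSingularHomologyIso A q).toLinearEquiv.toEquiv.subsingleton

lemma OneDim.nonempty_homology_equiv {q : ℕ} (h : OneDim Set.univ A q) : Nonempty
    (relativeSingularHomology (ZMod 2) (TopPair.ofSubset (X := TopCat.of X) A) q
      ≃ₗ[ZMod 2] ZMod 2) := by
  have h' := (sameClasses_relativeSingularChainComplex A q).hasTwoClasses h
  obtain ⟨e⟩ := nonempty_homology_equiv_of_hasTwoClasses (S := (relativeSingularChainComplex (ZMod 2)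
    (TopPair.ofSubset (X := TopCat.of X) A)).sc' (q + 1) q ((ComplexShape.down ℕ).next q)) h'
  exact ⟨(relativeSingularHomologyIso A q).toLinearEquiv.trans e⟩

end SingChain

theorem mainTheorem3 (m : ℕ) :
    (∀ q : ℕ, m ≤ q → q ≤ 2 * m →
      Nonempty (relativeSingularHomology (ZMod 2) (symmetricSquarePair (unitSphere m)) q
        ≃ₗ[ZMod 2] ZMod 2)) ∧
    (∀ q : ℕ, ¬ (m ≤ q ∧ q ≤ 2 * m) →
      Subsingleton (relativeSingularHomology (ZMod 2) (symmetricSquarePair (unitSphere m)) q)) ∧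
    Cardinal.sum (fun q : ℕ => Module.rank (ZMod 2)
      (relativeSingularHomology (ZMod 2) (symmetricSquarePair (unitSphere m)) q)) = m + 1 := by
  obtain ⟨h1, h2⟩ := SphereSquare.oneDim_and_acyclic_diagSet m
  have h1' (q : ℕ) (hq : m ≤ q) (hq' : q ≤ 2 * m) :
      Nonempty (relativeSingularHomology (ZMod 2) (symmetricSquarePair (unitSphere m)) q
        ≃ₗ[ZMod 2] ZMod 2) := (h1 q hq hq').nonempty_homology_equiv
  have h2' (q : ℕ) (hq : ¬ (m ≤ q ∧ q ≤ 2 * m)) :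
      Subsingleton (relativeSingularHomology (ZMod 2) (symmetricSquarePair (unitSphere m)) q) :=
    (h2 q hq).subsingleton_homology
  refine ⟨h1', h2', ?_⟩
  -- The rank in degree `q` is the cardinality of a type with an element exactly if `m ≤ q ≤ 2 * m`,
  -- so that the sum of the ranks counts these degrees.
  have hrank (q : ℕ) : Module.rank (ZMod 2)
      (relativeSingularHomology (ZMod 2) (symmetricSquarePair (unitSphere m)) q) =
        Cardinal.mk {x : Unit // m ≤ q ∧ q ≤ 2 * m} := by
    by_cases hq : m ≤ q ∧ q ≤ 2 * m
    · obtain ⟨e⟩ := h1' q hq.1 hq.2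
      rw [e.rank_eq, Module.rank_self]
      have : Unique {x : Unit // m ≤ q ∧ q ≤ 2 * m} := ⟨⟨⟨(), hq⟩⟩, fun _ => rfl⟩
      exact (Cardinal.mk_eq_one _).symm
    · have := h2' q hq
      have : IsEmpty {x : Unit // m ≤ q ∧ q ≤ 2 * m} := ⟨fun x => hq x.2⟩
      rw [rank_subsingleton', Cardinal.mk_eq_zero]
  have e : (Σ q : ℕ, {x : Unit // m ≤ q ∧ q ≤ 2 * m}) ≃ Finset.Icc m (2 * m) :=
    { toFun x := ⟨x.1, Finset.mem_Icc.2 x.2.2⟩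
      invFun q := ⟨q, (), Finset.mem_Icc.1 q.2⟩
      left_inv _ := rfl
      right_inv _ := rfl }
  simp_rw [hrank]
  rw [← Cardinal.mk_sigma, Cardinal.mk_congr e, Cardinal.mk_coe_finset, Nat.card_Icc,
    show 2 * m + 1 - m = m + 1 by omega]
  norm_cast
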